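/- A finite family of lines in $\mathbb{R}^2$ is in general position if no three of its lines are concurrent, no two are parallel and none is vertical. A family of $n$ lines in general position is in convex position if some connected component $P$ of the complement of the union of the $n$ lines is such that the boundary of $P$ contains a (nondegenerate) segment of each of the $n$ lines. A family spans an $n$-cell if it contains $n$ lines in convex position. Theorem. Let $k\ge 2$ be an integer. There is a family of exactly $$2\binom{2k-2}{k-1}^2$$ lines in general position that spans no $(2k+2)$-cell. There is also a family of exactly $$2\left(\binom{2k-2}{k-1}+1\right)\binom{2k-3}{k-1}$$ lines in general position that spans no $(2k+1)$-cell. -/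

import Mathlib

namespace LineArrangement

/-- Affine subspaces of the plane `ℝ²`; the lines are those satisfying `IsLine`. -/
abbrev Flat : Type := AffineSubspace ℝ (ℝ × ℝ)

/-- A line of the plane: an affine subspace of dimension one.
(The empty subspace has trivial direction, hence is not a line.) -/
def IsLine (a : Flat) : Prop := Module.finrank ℝ a.direction = 1

/-- A line is vertical if its direction contains the vector `(0, 1)`. -/
def IsVertical (a : Flat) : Prop := ((0, 1) : ℝ × ℝ) ∈ a.direction

/-- A finite family of lines in general position: no three lines are concurrent,
no two are parallel and none is vertical. -/
structure InGeneralPosition (F : Finset Flat) : Prop where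
  isLine : ∀ a ∈ F, IsLine a
  not_vertical : ∀ a ∈ F, ¬ IsVertical a
  not_parallel : ∀ a ∈ F, ∀ b ∈ F, a ≠ b → ¬ a.Parallel b
  not_concurrent : ∀ a ∈ F, ∀ b ∈ F, ∀ c ∈ F, a ≠ b → a ≠ c → b ≠ c →
    ¬ ∃ p : ℝ × ℝ, p ∈ a ∧ p ∈ b ∧ p ∈ c

/-- The complement of the union of the lines of the family. -/
def complementOfUnion (G : Finset Flat) : Set (ℝ × ℝ) :=
  (⋃ a ∈ G, (a : Set (ℝ × ℝ)))ᶜ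

/-- `P` is a cell of the family: a connected component of the complement of the union. -/
def IsCell (G : Finset Flat) (P : Set (ℝ × ℝ)) : Prop :=
  ∃ x ∈ complementOfUnion G, P = connectedComponentIn (complementOfUnion G) x

/-- The boundary of `P` contains a (nondegenerate) segment of the line `a`. -/
def IsSide (P : Set (ℝ × ℝ)) (a : Flat) : Prop :=
  ∃ p q : ℝ × ℝ, p ≠ q ∧ segment ℝ p q ⊆ frontier P ∩ (a : Set (ℝ × ℝ))

/-- The family defines a `k`-cell: some cell of the family has a boundary that contains
a segment from exactly `k` of the lines. -/
def DefinesCell (G : Finset Flat) (k : ℕ) : Prop :=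
  ∃ P : Set (ℝ × ℝ), IsCell G P ∧ {a : Flat | a ∈ G ∧ IsSide P a}.ncard = k

/-- A family of `n` lines is in convex position if it defines an `n`-cell. -/
def InConvexPosition (G : Finset Flat) : Prop := DefinesCell G G.card

/-- A family spans an `n`-cell if it contains `n` lines in convex position. -/
def SpansCell (F : Finset Flat) (n : ℕ) : Prop :=
  ∃ G : Finset Flat, G ⊆ F ∧ G.card = n ∧ InConvexPosition G

end LineArrangement

/-!
The families are unions of flattened copies of the families of Erdős and Szekeres, arranged so that
the two chains of sides bounding a cell, the upper and the lower one, cannot both be long.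

A cell with sides in the lines of `G` splits `G` into the upper sides `U` and the lower sides `L`,
and the abscissa of a suitable point of each side is compared with the abscissas at which this line
crosses the others (`CrossingPattern.Bounds`, `CrossingPattern.IsRealizedBy.exists_bounds`). So it
is enough to control the order of the slopes and the abscissas of the crossings. Both are prescribed
by binary words: the line of a word `w` has slope `∑ ε ^ e` over the positions `e` of the ones of
`w`, and for small `ε` and any numbers `t e` the intercept can be chosen so that two lines whose
words first differ at position `e` cross near the abscissa `t e` (`abs_wordCrossing_sub_lt`).

The words consist of a name of a bundle (positions below `h`) and a name within the bundle. Within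
each of the two parts a later first difference puts the crossing further to the left, and crossings
within a bundle lie to the right of all others. In a chain of upper sides the steepest line has a
one at its first differences with the other lines, and these positions are distinct if they belong
to one part; so bounds for the numbers of ones and zeros in the words bound the chains, as in the
theorem of Erdős and Szekeres (`CrossingPattern.Bounds.card_upper_le`). A chain contains several
lines of one bundle only at its right end, since the crossings of a bundle are far to the right. Let
`i` be the least steep upper side and `j` the steepest lower side. If `j` is less steep than `i`, or
in the same bundle, the cell may reach the crossings within these two bundles, but then it has at
most one side outside them (`CrossingPattern.Bounds.card_le_of_rightOpen`). Otherwise its sides lie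
in distinct bundles, apart from coincidences between `U` and `L`, and splitting the words at their
first two letters bounds `|U| + |L|` by `2k` (`CrossingPattern.Bounds.card_le_of_split`).

Each of the two halves of the family (leading letter zero or one) has `C(2k-2, k-1) + 1` bundles.
With `C(2k-2, k-1)` lines in each bundle there are no `(2k+2)`-cells. With `C(2k-3, k-1)` lines in
each bundle, where the bundles of one half have shorter upper chains and those of the other half
shorter lower chains, there are no `(2k+1)`-cells. The first of these families is slightly larger
than required, and a subfamily is taken.
-/

namespace LineArrangement

/-! ### Crossing patterns -/

/-- The combinatorial data of a family of non-vertical lines indexed by binary words: `m` is the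
slope, `X a b` the abscissa of the crossing of `a` and `b`, `bit a` the word of `a` and `d a b` the
first position where the words of `a` and `b` differ. Slopes are ordered lexicographically. The
position `d a b` governs `X a b`: among the positions below `h`, and among those from `h` on, a
later difference puts the crossing further to the left, while all crossings governed by a position
from `h` on lie to the right of those governed by a position below `h`.
The fields `mediant` and `mediant'` express that the extreme two of three lines cross between the
other two crossings. The values of `X` and `d` on the diagonal are meaningless. -/
structure CrossingPattern (ι : Type*) where
  m : ι → ℝ
  X : ι → ι → ℝ
  d : ι → ι → ℕ
  bit : ι → ℕ → Bool
  h : ℕ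
  m_inj : ∀ a b, m a = m b → a = b
  X_comm : ∀ a b, X a b = X b a
  d_comm : ∀ a b, d a b = d b a
  bit_left : ∀ a b, m a < m b → bit a (d a b) = false
  bit_right : ∀ a b, m a < m b → bit b (d a b) = true
  bit_agree : ∀ a b e, e < d a b → bit a e = bit b e
  mediant : ∀ a b c, m a < m b → m b < m c → X a b < X a c → X a c < X b c
  mediant' : ∀ a b c, m a < m b → m b < m c → X b c < X a c → X a c < X a b
  X_lt_of_deeper : ∀ a b c e, a ≠ b → c ≠ e → d c e < d a b → (d a b < h ∨ h ≤ d c e) →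
    X a b < X c e
  X_lt_of_bundle : ∀ a b c e, a ≠ b → c ≠ e → d c e < h → h ≤ d a b → X c e < X a b

namespace CrossingPattern

variable {ι : Type*} (T : CrossingPattern ι)

/-- The pattern of the mirror images of the lines under `(x, y) ↦ (x, -y)`: abscissas of crossings
are unchanged, slopes change sign, and the words are complemented. -/
def dual : CrossingPattern ι where
  m a := - T.m a
  X := T.X
  d := T.d
  bit a e := ! T.bit a e
  h := T.h
  m_inj a b hab := T.m_inj a b (neg_injective hab)
  X_comm := T.X_comm
  d_comm := T.d_comm
  bit_left a b hab := by
    rw [T.d_comm, T.bit_right b a (neg_lt_neg_iff.1 hab)]; rfl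
  bit_right a b hab := by
    rw [T.d_comm, T.bit_left b a (neg_lt_neg_iff.1 hab)]; rfl
  bit_agree a b e he := by rw [T.bit_agree a b e he]
  mediant a b c hab hbc hX := by
    have := T.mediant' c b a (neg_lt_neg_iff.1 hbc) (neg_lt_neg_iff.1 hab)
    rw [T.X_comm b a, T.X_comm c a, T.X_comm c b] at this
    exact this hX
  mediant' a b c hab hbc hX := by
    have := T.mediant c b a (neg_lt_neg_iff.1 hbc) (neg_lt_neg_iff.1 hab)
    rw [T.X_comm b a, T.X_comm c a, T.X_comm c b] at this
    exact this hX
  X_lt_of_deeper := T.X_lt_of_deeper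
  X_lt_of_bundle := T.X_lt_of_bundle

@[simp] theorem dual_bit (a : ι) (e : ℕ) : T.dual.bit a e = ! T.bit a e := rfl

@[simp] theorem dual_h : T.dual.h = T.h := rfl

variable {T}

theorem ne_of_m_lt {a b : ι} (hab : T.m a < T.m b) : a ≠ b := by
  rintro rfl; exact lt_irrefl _ hab

theorem m_lt_or_lt {a b : ι} (hab : a ≠ b) : T.m a < T.m b ∨ T.m b < T.m a :=
  lt_or_gt_of_ne fun h => hab (T.m_inj _ _ h)

theorem ultrametric {a b c : ι} (hab : T.m a < T.m b) (hbc : T.m b < T.m c) :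
    (T.d a b < T.d b c ∧ T.d a c = T.d a b) ∨ (T.d b c < T.d a b ∧ T.d a c = T.d b c) := by
  have h1 := T.bit_left a b hab
  have h2 := T.bit_right a b hab
  have h3 := T.bit_left b c hbc
  have h4 := T.bit_right b c hbc
  have h5 := T.bit_left a c (hab.trans hbc)
  have h6 := T.bit_right a c (hab.trans hbc)
  have hge : T.d a b ≤ T.d a c ∨ T.d b c ≤ T.d a c := by
    by_contra! hcon
    rw [T.bit_agree a b _ hcon.1, T.bit_agree b c _ hcon.2, h6] at h5
    exact absurd h5 (by simp)
  rcases lt_trichotomy (T.d a b) (T.d b c) with hlt | heq | hlt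
  · left
    refine ⟨hlt, le_antisymm ?_ (by omega)⟩
    by_contra! hcon
    rw [T.bit_agree a c _ hcon, ← T.bit_agree b c _ hlt, h2] at h1
    exact absurd h1 (by simp)
  · rw [heq, h3] at h2
    exact absurd h2 (by simp)
  · right
    refine ⟨hlt, le_antisymm ?_ (by omega)⟩
    by_contra! hcon
    rw [← T.bit_agree a c _ hcon, T.bit_agree a b _ hlt, h3] at h4
    exact absurd h4 (by simp)

/-- If `c` splits off from `a` before `b` does, then `b` is on the same side of `c` as `a`. -/
theorem near_right {a b c : ι} (hca : T.m c < T.m a) (hd : T.d c a < T.d a b) :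
    T.m c < T.m b ∧ T.d c b = T.d c a := by
  rcases eq_or_ne a b with rfl | hab
  · exact ⟨hca, rfl⟩
  rcases eq_or_ne b c with rfl | hbc
  · rw [T.d_comm] at hd; exact absurd hd (lt_irrefl _)
  have hdab := T.d_comm a b
  rcases T.m_lt_or_lt hab with h | h
  · rcases ultrametric hca h with h' | h' <;> exact ⟨hca.trans h, by omega⟩
  rcases T.m_lt_or_lt hbc with h2 | h2
  · rcases ultrametric h2 hca with h' | h' <;> omega
  · rcases ultrametric h2 h with h' | h' <;> exact ⟨h2, by omega⟩

theorem near_left {a b c : ι} (hac : T.m a < T.m c) (hd : T.d c a < T.d a b) :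
    T.m b < T.m c ∧ T.d c b = T.d c a := by
  obtain ⟨h1, h2⟩ := near_right (T := T.dual) (a := a) (b := b) (c := c) (neg_lt_neg hac) hd
  exact ⟨neg_lt_neg_iff.1 h1, h2⟩

variable (T)

/-- The number of ones of the word of `a` at positions in `[lo, hi)`. -/
def ones (a : ι) (lo hi : ℕ) : ℕ := ((Finset.Ico lo hi).filter fun e => T.bit a e = true).card

/-- The number of zeros of the word of `a` at positions in `[lo, hi)`. -/
def zeros (a : ι) (lo hi : ℕ) : ℕ := ((Finset.Ico lo hi).filter fun e => T.bit a e = false).card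

@[simp] theorem dual_ones (a : ι) (lo hi : ℕ) : T.dual.ones a lo hi = T.zeros a lo hi := by
  simp [ones, zeros]

@[simp] theorem dual_zeros (a : ι) (lo hi : ℕ) : T.dual.zeros a lo hi = T.ones a lo hi := by
  simp [ones, zeros]

variable {T}

theorem ones_le_of_bit_false {a : ι} {lo hi : ℕ} (h : T.bit a lo = false) :
    T.ones a lo hi ≤ T.ones a (lo + 1) hi := by
  refine Finset.card_le_card fun e he => ?_
  simp only [Finset.mem_filter, Finset.mem_Ico] at he ⊢
  refine ⟨⟨?_, he.1.2⟩, he.2⟩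
  rcases Nat.lt_or_ge lo e with h' | h'
  · exact h'
  · have : e = lo := by omega
    subst this; rw [h] at he; simp at he

theorem ones_succ_lt_of_bit_true {a : ι} {lo hi : ℕ} (h : T.bit a lo = true) (hlt : lo < hi) :
    T.ones a (lo + 1) hi + 1 = T.ones a lo hi := by
  unfold ones
  rw [← Finset.insert_Ico_add_one_left_eq_Ico hlt, Finset.filter_insert, if_pos h,
    Finset.card_insert_of_notMem (by simp)]

theorem ones_le_succ (a : ι) (lo hi : ℕ) : T.ones a lo hi ≤ T.ones a (lo + 1) hi + 1 := by
  rcases Nat.lt_or_ge lo hi with hlt | hge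
  · rcases hb : T.bit a lo with _ | _
    · exact (ones_le_of_bit_false hb).trans (Nat.le_succ _)
    · exact (ones_succ_lt_of_bit_true hb hlt).ge
  · simp [ones, Finset.Ico_eq_empty_of_le hge]

/-! ### Cells of a crossing pattern -/

variable (T)

/-- The lines of `U` and `L` bound a common cell from above and from below respectively, and each
of them contributes a side to it: `x a` is the abscissa of a point of the line `a` that lies
strictly below the other lines of `U` and strictly above the other lines of `L`. -/
structure Bounds (U L : Finset ι) (x : ι → ℝ) : Prop where
  disj : Disjoint U L
  uu : ∀ a ∈ U, ∀ b ∈ U, T.m a < T.m b → x b < T.X a b ∧ T.X a b < x a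
  ll : ∀ a ∈ L, ∀ b ∈ L, T.m a < T.m b → x a < T.X a b ∧ T.X a b < x b
  lu : ∀ a ∈ L, ∀ b ∈ U, T.m a < T.m b → T.X a b < x a ∧ T.X a b < x b
  ul : ∀ a ∈ U, ∀ b ∈ L, T.m a < T.m b → x a < T.X a b ∧ x b < T.X a b

variable {T} {U L : Finset ι} {x : ι → ℝ}

theorem Bounds.dual (B : T.Bounds U L x) : T.dual.Bounds L U x where
  disj := B.disj.symm
  uu a ha b hb hab := by
    have := B.ll b hb a ha (neg_lt_neg_iff.1 hab)
    rw [T.X_comm] at this; exact this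
  ll a ha b hb hab := by
    have := B.uu b hb a ha (neg_lt_neg_iff.1 hab)
    rw [T.X_comm] at this; exact this
  lu a ha b hb hab := by
    have := B.lu b hb a ha (neg_lt_neg_iff.1 hab)
    rw [T.X_comm] at this; exact this.symm
  ul a ha b hb hab := by
    have := B.ul b hb a ha (neg_lt_neg_iff.1 hab)
    rw [T.X_comm] at this; exact this.symm

theorem Bounds.mono (B : T.Bounds U L x) {U' L' : Finset ι} (hU : U' ⊆ U) (hL : L' ⊆ L) :
    T.Bounds U' L' x where
  disj := Finset.disjoint_of_subset_left hU (Finset.disjoint_of_subset_right hL B.disj)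
  uu a ha b hb := B.uu a (hU ha) b (hU hb)
  ll a ha b hb := B.ll a (hL ha) b (hL hb)
  lu a ha b hb := B.lu a (hL ha) b (hU hb)
  ul a ha b hb := B.ul a (hU ha) b (hL hb)

/-- The cups-versus-caps bound of Erdős and Szekeres: the steepest line of a chain of upper sides
has a one at its first difference with each of the other lines, and these positions are distinct. -/
theorem Bounds.card_upper_le (B : T.Bounds U L x) {V : Finset ι} (hV : V ⊆ U) {lo hi r : ℕ}
    (hd : ∀ a ∈ V, ∀ b ∈ V, a ≠ b → lo ≤ T.d a b ∧ T.d a b < hi) (hh : hi ≤ T.h ∨ T.h ≤ lo)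
    (hr : ∀ a ∈ V, T.ones a lo hi + 1 ≤ r) : V.card ≤ r := by
  classical
  rcases V.eq_empty_or_nonempty with rfl | hne
  · simp
  obtain ⟨u, hu, hmax⟩ := V.exists_max_image T.m hne
  have hlt : ∀ a ∈ V.erase u, T.m a < T.m u := fun a ha =>
    lt_of_le_of_ne (hmax a (Finset.mem_of_mem_erase ha))
      fun h => Finset.ne_of_mem_erase ha (T.m_inj _ _ h)
  have key : ∀ a ∈ V.erase u, ∀ b ∈ V.erase u, T.m a < T.m b → T.d a u ≠ T.d b u := by
    intro a ha b hb hab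
    have hau := Finset.mem_of_mem_erase ha
    have hbu := Finset.mem_of_mem_erase hb
    have h1 := (B.uu a (hV hau) b (hV hbu) hab).1
    have h2 := (B.uu b (hV hbu) u (hV hu) (hlt b hb)).2
    have d1 := hd a hau b hbu (ne_of_m_lt hab)
    have d2 := hd b hbu u hu (ne_of_m_lt (hlt b hb))
    rcases ultrametric hab (hlt b hb) with h | h
    · omega
    · have := T.X_lt_of_deeper a b b u (ne_of_m_lt hab) (ne_of_m_lt (hlt b hb)) h.1 (by omega)
      linarith
  have hcard : (V.erase u).card ≤ T.ones u lo hi := by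
    refine Finset.card_le_card_of_injOn (fun a => T.d a u) ?_ ?_
    · intro a ha
      have := hd a (Finset.mem_of_mem_erase ha) u hu (Finset.ne_of_mem_erase ha)
      simp only [Finset.coe_filter, Finset.mem_Ico, Set.mem_ofPred_eq]
      exact ⟨this, T.bit_right a u (hlt a ha)⟩
    · intro a ha b hb hab
      by_contra hne'
      rcases T.m_lt_or_lt hne' with h | h
      · exact key a ha b hb h hab
      · exact key b hb a ha h hab.symm
  have := hr u hu
  have := Finset.card_erase_add_one hu
  omega

theorem Bounds.card_lower_le (B : T.Bounds U L x) {V : Finset ι} (hV : V ⊆ L) {lo hi r : ℕ}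
    (hd : ∀ a ∈ V, ∀ b ∈ V, a ≠ b → lo ≤ T.d a b ∧ T.d a b < hi) (hh : hi ≤ T.h ∨ T.h ≤ lo)
    (hr : ∀ a ∈ V, T.zeros a lo hi + 1 ≤ r) : V.card ≤ r :=
  B.dual.card_upper_le hV hd hh (by simpa using hr)

/-- Only the bundle of the least steep upper side contains several upper sides. -/
theorem Bounds.bundle_upper (B : T.Bounds U L x) {i a b : ι} (hi : i ∈ U) (ha : a ∈ U)
    (hb : b ∈ U) (hia : T.m i < T.m a) (hab : T.m a < T.m b) (h : T.h ≤ T.d a b) :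
    T.h ≤ T.d i a := by
  by_contra! hcon
  have h1 := (B.uu a ha b hb hab).2
  have h2 := (B.uu i hi a ha hia).1
  have := T.X_lt_of_bundle a b i a (ne_of_m_lt hab) (ne_of_m_lt hia) hcon h
  linarith

theorem Bounds.bundle_lower (B : T.Bounds U L x) {j a b : ι} (hj : j ∈ L) (ha : a ∈ L)
    (hb : b ∈ L) (hja : T.m a < T.m j) (hab : T.m b < T.m a) (h : T.h ≤ T.d a b) :
    T.h ≤ T.d a j := by
  have := B.dual.bundle_upper hj ha hb (neg_lt_neg hja) (neg_lt_neg hab) h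
  rwa [T.d_comm]

/-! ### Cells that are open to the right -/

variable (T) in
/-- `a` belongs to the bundle of `i`: their words agree before position `h`. -/
def SameBundle (i a : ι) : Prop := a = i ∨ T.h ≤ T.d a i

section RightOpen

variable {i j : ι}

theorem Bounds.lower_outside (B : T.Bounds U L x) (hi : i ∈ U) (hj : j ∈ L)
    (hij : T.m j < T.m i ∨ T.h ≤ T.d j i) {c : ι} (hc : c ∈ L) (hcj : T.m c < T.m j)
    (hd : T.d c j < T.h) : T.d c j < T.d j i := by
  rcases hij with hij | hij
  · have h1 := (B.lu c hc i hi (hcj.trans hij)).1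
    have h2 := (B.ll c hc j hj hcj).1
    rcases ultrametric hcj hij with h | h
    · exact h.1
    · have := T.X_lt_of_deeper c j c i (ne_of_m_lt hcj) (ne_of_m_lt (hcj.trans hij)) (by omega)
        (by omega)
      linarith
  · omega

theorem Bounds.not_two_lower_outside (B : T.Bounds U L x) (hi : i ∈ U) (hj : j ∈ L)
    (hij : T.m j < T.m i ∨ T.h ≤ T.d j i) {c c' : ι} (hc : c ∈ L) (hc' : c' ∈ L)
    (hcc : T.m c < T.m c') (hcj : T.m c' < T.m j) (hd : T.d c j < T.h) (hd' : T.d c' j < T.h) :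
    False := by
  have e1 := B.lower_outside hi hj hij hc (hcc.trans hcj) hd
  have n1 := near_right (hcc.trans hcj) e1
  have h1 := (B.ll c hc c' hc' hcc).1
  have h2 := (B.ll c hc c' hc' hcc).2
  have h3 := (B.ll c' hc' j hj hcj).1
  have h4 := (B.lu c hc i hi n1.1).1
  have hdcc : T.d c c' < T.h := by
    by_contra! hcon
    have := B.bundle_lower hj hc' hc hcj hcc (by rwa [T.d_comm])
    omega
  rcases ultrametric hcc hcj with h | h
  · have := T.X_lt_of_deeper c' j c c' (ne_of_m_lt hcj) (ne_of_m_lt hcc) h.1 (by omega)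
    linarith
  · have := T.X_lt_of_deeper c c' c i (ne_of_m_lt hcc) (ne_of_m_lt n1.1) (by omega) (by omega)
    linarith

/-- If the steepest lower side `j` is not steeper than the least steep upper side `i` (or is in the
same bundle), then at most one side lies outside the bundles of these two lines, and none does if
the words of `i` and `j` differ already in the first letter. -/
theorem Bounds.card_le_of_rightOpen (B : T.Bounds U L x) (hi : i ∈ U) (hj : j ∈ L)
    (hmin : ∀ a ∈ U, T.m i ≤ T.m a) (hmax : ∀ a ∈ L, T.m a ≤ T.m j)
    (hij : T.m j < T.m i ∨ T.h ≤ T.d j i) [DecidablePred (T.SameBundle i)]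
    [DecidablePred (T.SameBundle j)] :
    U.card + L.card ≤ (U.filter (T.SameBundle i)).card + (L.filter (T.SameBundle j)).card + 1 ∧
    (T.d j i = 0 →
      U.card + L.card ≤ (U.filter (T.SameBundle i)).card + (L.filter (T.SameBundle j)).card) := by
  have hij' : T.dual.m i < T.dual.m j ∨ T.dual.h ≤ T.dual.d i j := by
    rcases hij with h | h
    · exact Or.inl (neg_lt_neg h)
    · right; rw [T.dual.d_comm]; exact h
  have hL : ∀ c ∈ L.filter (fun a => ¬ T.SameBundle j a),
      c ∈ L ∧ T.m c < T.m j ∧ T.d c j < T.h := by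
    intro c hc
    obtain ⟨h1, h2⟩ := Finset.mem_filter.1 hc
    simp only [SameBundle, not_or, not_le] at h2
    exact ⟨h1, lt_of_le_of_ne (hmax c h1) fun h => h2.1 (T.m_inj _ _ h), h2.2⟩
  have hU : ∀ c ∈ U.filter (fun a => ¬ T.SameBundle i a),
      c ∈ U ∧ T.m i < T.m c ∧ T.d c i < T.h := by
    intro c hc
    obtain ⟨h1, h2⟩ := Finset.mem_filter.1 hc
    simp only [SameBundle, not_or, not_le] at h2
    exact ⟨h1, lt_of_le_of_ne (hmin c h1) fun h => h2.1 (T.m_inj _ _ h).symm, h2.2⟩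
  have hL1 : (L.filter (fun a => ¬ T.SameBundle j a)).card ≤ 1 := by
    refine Finset.card_le_one.2 fun c hc c' hc' => ?_
    obtain ⟨a1, a2, a3⟩ := hL c hc
    obtain ⟨b1, b2, b3⟩ := hL c' hc'
    by_contra hne
    rcases T.m_lt_or_lt hne with h | h
    · exact B.not_two_lower_outside hi hj hij a1 b1 h b2 a3 b3
    · exact B.not_two_lower_outside hi hj hij b1 a1 h a2 b3 a3
  have hU1 : (U.filter (fun a => ¬ T.SameBundle i a)).card ≤ 1 := by
    refine Finset.card_le_one.2 fun c hc c' hc' => ?_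
    obtain ⟨a1, a2, a3⟩ := hU c hc
    obtain ⟨b1, b2, b3⟩ := hU c' hc'
    by_contra hne
    rcases T.m_lt_or_lt hne with h | h
    · exact B.dual.not_two_lower_outside hj hi hij' b1 a1 (neg_lt_neg h) (neg_lt_neg a2) b3 a3
    · exact B.dual.not_two_lower_outside hj hi hij' a1 b1 (neg_lt_neg h) (neg_lt_neg b2) a3 b3
  have hLd : ∀ c ∈ L.filter (fun a => ¬ T.SameBundle j a), T.d c j < T.d j i := by
    intro c hc
    obtain ⟨a1, a2, a3⟩ := hL c hc
    exact B.lower_outside hi hj hij a1 a2 a3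
  have hUd : ∀ c ∈ U.filter (fun a => ¬ T.SameBundle i a), T.d c i < T.d j i := by
    intro c hc
    obtain ⟨a1, a2, a3⟩ := hU c hc
    rw [T.d_comm j i]
    exact B.dual.lower_outside hj hi hij' a1 (neg_lt_neg a2) a3
  have hboth : (L.filter (fun a => ¬ T.SameBundle j a)) = ∅ ∨
      (U.filter (fun a => ¬ T.SameBundle i a)) = ∅ := by
    by_contra! hcon
    obtain ⟨⟨c, hc⟩, ⟨c', hc'⟩⟩ := hcon
    have e1 := hLd c hc
    have e2 := hUd c' hc'
    obtain ⟨a1, a2, a3⟩ := hL c hc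
    obtain ⟨b1, b2, b3⟩ := hU c' hc'
    have n1 := near_right a2 e1
    have n2 := near_left (c := c') (a := i) (b := j) b2 (by rwa [T.d_comm i j])
    have hcc := a2.trans n2.1
    have h1 := (B.lu c a1 c' b1 hcc)
    have h2 := (B.ll c a1 j hj a2).1
    have h3 := (B.uu i hi c' b1 b2).1
    have s1 := T.d_comm c' i
    have s2 := T.d_comm c' j
    rcases ultrametric a2 n2.1 with h | h
    · have := T.X_lt_of_deeper i c' c c' (ne_of_m_lt b2) (ne_of_m_lt hcc) (by omega) (by omega)
      linarith
    · have := T.X_lt_of_deeper c j c c' (ne_of_m_lt a2) (ne_of_m_lt hcc) (by omega) (by omega)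
      linarith
  have sU := Finset.card_filter_add_card_filter_not (s := U) (T.SameBundle i)
  have sL := Finset.card_filter_add_card_filter_not (s := L) (T.SameBundle j)
  refine ⟨?_, fun h0 => ?_⟩
  · rcases hboth with h | h <;> have := congrArg Finset.card h <;>
      rw [Finset.card_empty] at this <;> omega
  · have z1 : (L.filter (fun a => ¬ T.SameBundle j a)) = ∅ :=
      Finset.eq_empty_of_forall_notMem fun c hc => by have := hLd c hc; omega
    have z2 : (U.filter (fun a => ¬ T.SameBundle i a)) = ∅ :=
      Finset.eq_empty_of_forall_notMem fun c hc => by have := hUd c hc; omega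
    rw [z1, Finset.card_empty] at sL
    rw [z2, Finset.card_empty] at sU
    omega

end RightOpen

/-! ### Words and bundles -/

variable {i j : ι}

theorem bit_d_ne {a b : ι} (hab : a ≠ b) : T.bit a (T.d a b) ≠ T.bit b (T.d a b) := by
  rcases T.m_lt_or_lt hab with h | h
  · rw [T.bit_left a b h, T.bit_right a b h]; simp
  · rw [T.d_comm, T.bit_left b a h, T.bit_right b a h]; simp

theorem SameBundle.bit_eq {a : ι} (h : T.SameBundle i a) {e : ℕ} (he : e < T.h) :
    T.bit a e = T.bit i e := by
  rcases h with rfl | h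
  · rfl
  · exact T.bit_agree a i e (he.trans_le h)

theorem SameBundle.le_d {a b : ι} (ha : T.SameBundle i a) (hb : T.SameBundle i b) (hab : a ≠ b) :
    T.h ≤ T.d a b := by
  by_contra! hcon
  exact bit_d_ne hab ((ha.bit_eq hcon).trans (hb.bit_eq hcon).symm)

/-- Lines whose words take different values at position `r` cross as governed by `r`, provided all
words agree before `r`. -/
theorem d_eq_of_bit {a b : ι} {r : ℕ} (hr : a ≠ b → r ≤ T.d a b) (ha : T.bit a r = false)
    (hb : T.bit b r = true) : T.m a < T.m b ∧ T.d a b = r := by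
  have hne : a ≠ b := by rintro rfl; rw [ha] at hb; simp at hb
  have hd : T.d a b = r := by
    refine le_antisymm ?_ (hr hne)
    by_contra! hcon
    have := T.bit_agree a b r hcon
    rw [ha, hb] at this; simp at this
  refine ⟨?_, hd⟩
  rcases T.m_lt_or_lt hne with h | h
  · exact h
  · have := T.bit_left b a h
    rw [T.d_comm, hd, hb] at this; simp at this

theorem lt_d_of_bit {a b : ι} {r : ℕ} (hne : a ≠ b) (hr : r ≤ T.d a b)
    (hab : T.bit a r = T.bit b r) : r < T.d a b :=
  lt_of_le_of_ne hr fun h => bit_d_ne hne (by rw [← h]; exact hab)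

/-! ### Splitting a cell at a position of the words -/

section Split

variable {r : ℕ}

/-- If an upper side has a one at the splitting position, only one has a zero. -/
theorem Bounds.eq_of_bit_false (B : T.Bounds U L x)
    (hd : ∀ a ∈ U, ∀ b ∈ U, a ≠ b → r ≤ T.d a b ∧ T.d a b < T.h) {a a' b : ι}
    (ha : a ∈ U) (ha' : a' ∈ U) (hb : b ∈ U) (hab : T.bit a r = false) (hab' : T.bit a' r = false)
    (hbb : T.bit b r = true) : a = a' := by
  by_contra hne
  wlog hlt : T.m a < T.m a' generalizing a a'
  · exact this ha' ha hab' hab (Ne.symm hne) ((T.m_lt_or_lt hne).resolve_left hlt)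
  obtain ⟨h1, h2⟩ := d_eq_of_bit (fun h => (hd a' ha' b hb h).1) hab' hbb
  have h3 := lt_d_of_bit hne (hd a ha a' ha' hne).1 (hab.trans hab'.symm)
  have h4 := (B.uu a' ha' b hb h1).2
  have h5 := (B.uu a ha a' ha' hlt).1
  have := T.X_lt_of_deeper a a' a' b hne (ne_of_m_lt h1) (by omega)
    (Or.inl (hd a ha a' ha' hne).2)
  linarith

theorem Bounds.card_le_two_or_bit (B : T.Bounds U L x)
    (hd : ∀ a ∈ U, ∀ b ∈ U, a ≠ b → r ≤ T.d a b ∧ T.d a b < T.h)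
    (h1 : (U.filter fun a => T.bit a r = true).card ≤ 1) :
    U.card ≤ 2 ∨ ∀ a ∈ U, T.bit a r = false := by
  by_cases hU : ∀ a ∈ U, T.bit a r = false
  · exact Or.inr hU
  push Not at hU
  obtain ⟨b, hb, hbb⟩ := hU
  left
  have h2 : (U.filter fun a => ¬ T.bit a r = true).card ≤ 1 := by
    refine Finset.card_le_one.2 fun a ha a' ha' => ?_
    simp only [Finset.mem_filter, Bool.not_eq_true] at ha ha'
    exact B.eq_of_bit_false hd ha.1 ha'.1 hb ha.2 ha'.2 (by simpa using hbb)
  have := Finset.card_filter_add_card_filter_not (s := U) (fun a => T.bit a r = true)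
  omega

/-- A cell cut off by the upper side with a zero at the splitting position: the remaining sides
bound a cell that is open to the right, so there are few of them. -/
theorem Bounds.card_le_four [DecidableEq ι] (B : T.Bounds U L x)
    (hd : ∀ a ∈ U ∪ L, ∀ b ∈ U ∪ L, a ≠ b → r ≤ T.d a b)
    (hU : ∀ a ∈ U, ∀ b ∈ U, a ≠ b → T.d a b < T.h) (hL : ∀ a ∈ L, ∀ b ∈ L, a ≠ b → T.d a b < T.h)
    (hLne : L.Nonempty) (h2 : 2 ≤ (U.filter fun a => T.bit a r = true).card)
    (h0 : ∃ s ∈ U ∪ L, T.bit s r = false) : U.card + L.card ≤ 4 := by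
  classical
  have hdU : ∀ a ∈ U, ∀ b ∈ U, a ≠ b → r ≤ T.d a b ∧ T.d a b < T.h := fun a ha b hb hab =>
    ⟨hd a (Finset.mem_union_left _ ha) b (Finset.mem_union_left _ hb) hab, hU a ha b hb hab⟩
  -- Two upper sides with a one meet to the left of the crossings governed by `r`, whereas a lower
  -- side with a zero would keep the cell to the right of these.
  have hLbit : ∀ l ∈ L, T.bit l r = true := by
    intro l hl
    by_contra hlb
    rw [Bool.not_eq_true] at hlb
    obtain ⟨u, hu, u', hu', hne⟩ := Finset.one_lt_card.1 h2
    wlog hlt : T.m u < T.m u' generalizing u u'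
    · exact this u' hu' u hu (Ne.symm hne) ((T.m_lt_or_lt hne).resolve_left hlt)
    simp only [Finset.mem_filter] at hu hu'
    obtain ⟨h3, h4⟩ := d_eq_of_bit
      (hd l (Finset.mem_union_right _ hl) u' (Finset.mem_union_left _ hu'.1)) hlb hu'.2
    have h5 := (B.lu l hl u' hu'.1 h3).2
    have h6 := (B.uu u hu.1 u' hu'.1 hlt).1
    have h7 := lt_d_of_bit hne (hdU u hu.1 u' hu'.1 hne).1 (hu.2.trans hu'.2.symm)
    have := T.X_lt_of_deeper u u' l u' hne (ne_of_m_lt h3) (by omega)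
      (Or.inl (hU u hu.1 u' hu'.1 hne))
    linarith
  obtain ⟨s, hs, hs0⟩ := h0
  have hsU : s ∈ U := by
    rcases Finset.mem_union.1 hs with h | h
    · exact h
    · rw [hLbit s h] at hs0; simp at hs0
  set V := U.filter fun a => T.bit a r = true with hV
  have hVU : V ⊆ U := Finset.filter_subset _ _
  have hVne : V.Nonempty := Finset.card_pos.1 (by omega)
  obtain ⟨i, hi, hmin⟩ := V.exists_min_image T.m hVne
  obtain ⟨j, hj, hmax⟩ := L.exists_max_image T.m hLne
  have hiV := Finset.mem_filter.1 hi
  -- Otherwise `s` would meet `i` before `j`, which puts the crossing of `i` and `j` to the right of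
  -- those with `s`, although it is governed by a later position.
  have hji : T.m j < T.m i ∨ T.h ≤ T.d j i := by
    by_contra! hcon
    have hne : j ≠ i := by rintro rfl; exact Finset.disjoint_left.1 B.disj hiV.1 hj
    have hlt := (T.m_lt_or_lt hne).resolve_left hcon.1.not_gt
    obtain ⟨h3, h4⟩ := d_eq_of_bit (hd s hs i (Finset.mem_union_left _ hiV.1)) hs0 hiV.2
    obtain ⟨h5, h6⟩ := d_eq_of_bit (hd s hs j (Finset.mem_union_right _ hj)) hs0 (hLbit j hj)
    have h7 := (B.uu s hsU i hiV.1 h3).2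
    have h8 := (B.ul s hsU j hj h5).1
    have h9 := T.mediant s i j h3 hlt (h7.trans h8)
    have h10 := lt_d_of_bit hne.symm
      (hd i (Finset.mem_union_left _ hiV.1) j (Finset.mem_union_right _ hj) hne.symm)
      (hiV.2.trans (hLbit j hj).symm)
    have := T.X_lt_of_deeper i j s i hne.symm (ne_of_m_lt h3) (by omega)
      (Or.inl (by rw [T.d_comm]; exact hcon.2))
    linarith
  have key := ((B.mono hVU subset_rfl).card_le_of_rightOpen hi hj hmin hmax hji).1
  have c1 : (V.filter (T.SameBundle i)).card ≤ 1 := by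
    refine Finset.card_le_one.2 fun a ha b hb => ?_
    obtain ⟨ha1, ha2⟩ := Finset.mem_filter.1 ha
    obtain ⟨hb1, hb2⟩ := Finset.mem_filter.1 hb
    by_contra hne
    have := ha2.le_d hb2 hne
    have := hU a (hVU ha1) b (hVU hb1) hne
    omega
  have c2 : (L.filter (T.SameBundle j)).card ≤ 1 := by
    refine Finset.card_le_one.2 fun a ha b hb => ?_
    obtain ⟨ha1, ha2⟩ := Finset.mem_filter.1 ha
    obtain ⟨hb1, hb2⟩ := Finset.mem_filter.1 hb
    by_contra hne
    have := ha2.le_d hb2 hne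
    have := hL a ha1 b hb1 hne
    omega
  obtain ⟨v, hv⟩ := hVne
  have h3 : (U.filter fun a => ¬ T.bit a r = true).card ≤ 1 := by
    refine Finset.card_le_one.2 fun a ha a' ha' => ?_
    simp only [Finset.mem_filter, Bool.not_eq_true] at ha ha'
    exact B.eq_of_bit_false hdU ha.1 ha'.1 (hVU hv) ha.2 ha'.2 (Finset.mem_filter.1 hv).2
  have := Finset.card_filter_add_card_filter_not (s := U) (fun a => T.bit a r = true)
  rw [← hV] at this
  omega

end Split

/-! ### Balanced crossing patterns -/

variable (T) in
/-- The words have length `n` and consist of a leading letter, a name of a bundle at the positions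
in `[1, h)` and a name within the bundle at the positions in `[h, n)`. The numbers of ones and
zeros in the names are bounded as in the families of Erdős and Szekeres without long cups and
caps. The words whose two leading letters differ form, for each value of the leading letter, a
single bundle. -/
structure Balanced (n k : ℕ) (p q : Bool → ℕ) : Prop where
  two_le : 2 ≤ k
  two_le_h : 2 ≤ T.h
  d_lt : ∀ a b, a ≠ b → T.d a b < n
  ones_false : ∀ a, T.bit a 0 = false → T.ones a 1 T.h + 1 ≤ k
  zeros_false : ∀ a, T.bit a 0 = false → T.zeros a 1 T.h ≤ k
  ones_true : ∀ a, T.bit a 0 = true → T.ones a 1 T.h ≤ k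
  zeros_true : ∀ a, T.bit a 0 = true → T.zeros a 1 T.h + 1 ≤ k
  ones_bundle : ∀ a, T.ones a T.h n + 1 ≤ p (T.bit a 0)
  zeros_bundle : ∀ a, T.zeros a T.h n + 1 ≤ q (T.bit a 0)
  special : ∀ a b, a ≠ b → T.bit a 0 = T.bit b 0 → T.bit a 1 = (! T.bit a 0) →
    T.bit b 1 = (! T.bit b 0) → T.h ≤ T.d a b

variable {n k : ℕ} {p q : Bool → ℕ}

theorem Balanced.dual (H : T.Balanced n k p q) :
    T.dual.Balanced n k (fun b => q (!b)) (fun b => p (!b)) where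
  two_le := H.two_le
  two_le_h := H.two_le_h
  d_lt := H.d_lt
  ones_false a ha := by
    rw [dual_ones]; exact H.zeros_true a (by simpa using ha)
  zeros_false a ha := by
    rw [dual_zeros]; exact H.ones_true a (by simpa using ha)
  ones_true a ha := by
    rw [dual_ones]; exact H.zeros_false a (by simpa using ha)
  zeros_true a ha := by
    rw [dual_zeros]; exact H.ones_false a (by simpa using ha)
  ones_bundle a := by
    rw [dual_ones]; simpa using H.zeros_bundle a
  zeros_bundle a := by
    rw [dual_zeros]; simpa using H.ones_bundle a
  special a b hab h0 h1 h2 := by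
    simp only [dual_bit] at h0 h1 h2
    exact H.special a b hab (Bool.not_inj h0) (Bool.not_inj h1) (Bool.not_inj h2)

theorem Bounds.card_bundle_upper_le (B : T.Bounds U L x) (H : T.Balanced n k p q) (i : ι)
    [DecidablePred (T.SameBundle i)] : (U.filter (T.SameBundle i)).card ≤ p (T.bit i 0) := by
  refine B.card_upper_le (Finset.filter_subset _ _) (lo := T.h) (hi := n) ?_ (Or.inr le_rfl) ?_
  · intro a ha b hb hab
    exact ⟨(Finset.mem_filter.1 ha).2.le_d (Finset.mem_filter.1 hb).2 hab, H.d_lt a b hab⟩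
  · intro a ha
    rw [← (Finset.mem_filter.1 ha).2.bit_eq (by have := H.two_le_h; omega)]
    exact H.ones_bundle a

theorem Bounds.card_bundle_lower_le (B : T.Bounds U L x) (H : T.Balanced n k p q) (j : ι)
    [DecidablePred (T.SameBundle j)] : (L.filter (T.SameBundle j)).card ≤ q (T.bit j 0) := by
  have key := @Bounds.card_bundle_upper_le ι T.dual L U x n k _ _ B.dual H.dual j ‹_›
  simp only [dual_bit, Bool.not_not] at key
  exact key

/-- A chain of upper sides passes through few bundles, and only the last of these contributes more
than one line. -/
theorem Bounds.card_upper_le_of_balanced (B : T.Bounds U L x) (H : T.Balanced n k p q) {N : ℕ}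
    (h0 : k + 1 + p false ≤ N) (h1 : k + p true ≤ N) : U.card ≤ N := by
  classical
  have hh := H.two_le_h
  rcases U.eq_empty_or_nonempty with rfl | hne
  · simp
  obtain ⟨i, hi, hmin⟩ := U.exists_min_image T.m hne
  have hlt : ∀ a ∈ U, a ≠ i → T.m i < T.m a := fun a ha hai =>
    lt_of_le_of_ne (hmin a ha) fun h => hai (T.m_inj _ _ h).symm
  -- one line of each bundle: all bundles other than that of `i` contain only one upper side
  set V := insert i (U.filter fun a => ¬ T.SameBundle i a) with hV
  have hVU : V ⊆ U := Finset.insert_subset hi (Finset.filter_subset _ _)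
  have hcard : V.card = (U.filter fun a => ¬ T.SameBundle i a).card + 1 :=
    Finset.card_insert_of_notMem (by simp [SameBundle])
  have hsum := Finset.card_filter_add_card_filter_not (s := U) (T.SameBundle i)
  have hbundle := B.card_bundle_upper_le H i
  have hd : ∀ a ∈ V, ∀ b ∈ V, a ≠ b → T.d a b < T.h := by
    intro a ha b hb hab
    wlog hm : T.m a < T.m b generalizing a b
    · rw [T.d_comm]
      exact this b hb a ha hab.symm ((T.m_lt_or_lt hab).resolve_left hm)
    have hbi : b ≠ i := fun h => by
      have := hmin a (hVU ha)
      rw [h] at hm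
      exact absurd this hm.not_ge
    have hb' := (Finset.mem_filter.1 (Finset.mem_of_mem_insert_of_ne hb hbi)).2
    by_contra! hcon
    rcases eq_or_ne a i with rfl | hai
    · exact hb' (Or.inr (by rwa [T.d_comm]))
    · have ha' := (Finset.mem_filter.1 (Finset.mem_of_mem_insert_of_ne ha hai)).2
      exact ha' (Or.inr (by
        rw [T.d_comm]
        exact B.bundle_upper hi (hVU ha) (hVU hb) (hlt a (hVU ha) hai) hm hcon))
  have hones : ∀ a, T.ones a 1 T.h ≤ k := by
    intro a
    rcases hb : T.bit a 0 with _ | _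
    · have := H.ones_false a hb; omega
    · exact H.ones_true a hb
  rcases hb : T.bit i 0 with _ | _
  · have : V.card ≤ k + 2 := by
      refine B.card_upper_le hVU (lo := 0) (hi := T.h)
        (fun a ha b hb hab => ⟨Nat.zero_le _, hd a ha b hb hab⟩) (Or.inl le_rfl) fun a _ => ?_
      have := hones a
      have := T.ones_le_succ a 0 T.h
      simp only [zero_add] at this
      omega
    rw [hb] at hbundle
    omega
  · have : V.card ≤ k + 1 := by
      refine B.card_upper_le hVU (lo := 1) (hi := T.h)
        (fun a ha b hb' hab => ⟨?_, hd a ha b hb' hab⟩) (Or.inl le_rfl) fun a _ => ?_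
      · -- the least steep line has leading letter one, hence so have all the others
        have key : ∀ c ∈ V, T.bit c 0 = true := by
          intro c hc
          by_contra hc0
          rw [Bool.not_eq_true] at hc0
          have := (d_eq_of_bit (fun _ => Nat.zero_le _) hc0 hb).1
          exact absurd (hmin c (hVU hc)) this.not_ge
        exact lt_d_of_bit hab (Nat.zero_le _) ((key a ha).trans (key b hb').symm)
      · have := hones a
        omega
    rw [hb] at hbundle
    omega

theorem Bounds.card_lower_le_of_balanced (B : T.Bounds U L x) (H : T.Balanced n k p q) {N : ℕ}
    (h0 : k + 1 + q true ≤ N) (h1 : k + q false ≤ N) : L.card ≤ N :=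
  B.dual.card_upper_le_of_balanced H.dual h0 h1

/-- If the steepest lower side `j` is steeper than the least steep upper side `i` and lies in
another bundle, then no two upper sides lie in a common bundle. -/
theorem Bounds.d_lt_of_crossed (B : T.Bounds U L x) {i j : ι} (hi : i ∈ U) (hj : j ∈ L)
    (hmin : ∀ a ∈ U, T.m i ≤ T.m a) (hij : T.m i < T.m j) (hd : T.d i j < T.h) :
    ∀ a ∈ U, ∀ b ∈ U, a ≠ b → T.d a b < T.h := by
  intro a ha b hb hab
  wlog hm : T.m a < T.m b generalizing a b
  · rw [T.d_comm]
    exact this b hb a ha hab.symm ((T.m_lt_or_lt hab).resolve_left hm)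
  by_contra! hcon
  have hja : T.m a < T.m j ∧ T.d a j < T.h := by
    rcases eq_or_ne i a with rfl | hia
    · exact ⟨hij, hd⟩
    have hlt := lt_of_le_of_ne (hmin a ha) fun h => hia (T.m_inj _ _ h)
    have h1 := B.bundle_upper hi ha hb hlt hm hcon
    obtain ⟨h2, h3⟩ := near_left (a := i) (b := a) (c := j) hij (by rw [T.d_comm]; omega)
    refine ⟨h2, ?_⟩
    rw [T.d_comm, h3, T.d_comm]; exact hd
  have h4 := (B.ul a ha j hj hja.1).1
  have h5 := (B.uu a ha b hb hm).2
  have := T.X_lt_of_bundle a b a j hab (ne_of_m_lt hja.1) hja.2 hcon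
  linarith

/-- The case of a cell that meets both halves of a split. -/
theorem Bounds.card_le_of_split [DecidableEq ι] (B : T.Bounds U L x) {r : ℕ}
    (hd : ∀ a ∈ U ∪ L, ∀ b ∈ U ∪ L, a ≠ b → r ≤ T.d a b)
    (hU : ∀ a ∈ U, ∀ b ∈ U, a ≠ b → T.d a b < T.h) (hL : ∀ a ∈ L, ∀ b ∈ L, a ≠ b → T.d a b < T.h)
    (hUne : U.Nonempty) (hLne : L.Nonempty) (h0 : ∃ s ∈ U ∪ L, T.bit s r = false)
    (h1 : ∃ s ∈ U ∪ L, T.bit s r = true) {u l : ℕ} (hu : 2 ≤ u) (hl : 2 ≤ l)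
    (hUu : (∀ a ∈ U, T.bit a r = false) → U.card ≤ u)
    (hLl : (∀ a ∈ L, T.bit a r = true) → L.card ≤ l) : U.card + L.card ≤ u + l := by
  have hdual : ∀ s, T.dual.bit s r = true ↔ T.bit s r = false := by
    intro s; simp
  have hdual' : ∀ s, T.dual.bit s r = false ↔ T.bit s r = true := by
    intro s; simp
  rcases Nat.lt_or_ge 1 (U.filter fun a => T.bit a r = true).card with h2 | h2
  · have := B.card_le_four hd hU hL hLne h2 h0
    omega
  rcases Nat.lt_or_ge 1 (L.filter fun a => T.dual.bit a r = true).card with h3 | h3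
  · have := B.dual.card_le_four (r := r) (by rwa [Finset.union_comm L U]) hL hU hUne h3
      (by simpa only [hdual', Finset.union_comm L U] using h1)
    omega
  have h4 : U.card ≤ u := by
    rcases B.card_le_two_or_bit (fun a ha b hb hab =>
      ⟨hd a (Finset.mem_union_left _ ha) b (Finset.mem_union_left _ hb) hab, hU a ha b hb hab⟩)
      h2 with h | h
    · omega
    · exact hUu h
  have h5 : L.card ≤ l := by
    rcases B.dual.card_le_two_or_bit (fun a ha b hb hab =>
      ⟨hd a (Finset.mem_union_right _ ha) b (Finset.mem_union_right _ hb) hab, hL a ha b hb hab⟩)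
      h3 with h | h
    · omega
    · exact hLl fun a ha => (hdual' a).1 (h a ha)
  omega

/-- A cell all of whose sides have leading letter zero and lie in distinct bundles. -/
theorem Bounds.card_le_of_bit_false [DecidableEq ι] (B : T.Bounds U L x) (H : T.Balanced n k p q)
    (hU : ∀ a ∈ U, ∀ b ∈ U, a ≠ b → T.d a b < T.h) (hL : ∀ a ∈ L, ∀ b ∈ L, a ≠ b → T.d a b < T.h)
    (hUne : U.Nonempty) (hLne : L.Nonempty) (h0 : ∀ a ∈ U ∪ L, T.bit a 0 = false) :
    U.card + L.card ≤ 2 * k := by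
  have hk := H.two_le
  have hd : ∀ a ∈ U ∪ L, ∀ b ∈ U ∪ L, a ≠ b → 1 ≤ T.d a b := fun a ha b hb hab =>
    lt_d_of_bit hab (Nat.zero_le _) ((h0 a ha).trans (h0 b hb).symm)
  have hUk : U.card ≤ k :=
    B.card_upper_le subset_rfl (lo := 1) (hi := T.h)
      (fun a ha b hb hab =>
        ⟨hd a (Finset.mem_union_left _ ha) b (Finset.mem_union_left _ hb) hab, hU a ha b hb hab⟩)
      (Or.inl le_rfl) fun a ha => H.ones_false a (h0 a (Finset.mem_union_left _ ha))
  -- Words with leading letters `0` and `1` form a single bundle.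
  have hone : (∀ a ∈ L, T.bit a 1 = true) → L.card ≤ 1 := by
    intro h
    refine Finset.card_le_one.2 fun a ha b hb => ?_
    by_contra hne
    have ha0 := h0 a (Finset.mem_union_right _ ha)
    have hb0 := h0 b (Finset.mem_union_right _ hb)
    have h1 := H.special a b hne (ha0.trans hb0.symm) (by rw [ha0, h a ha]; rfl)
      (by rw [hb0, h b hb]; rfl)
    have h2 := hL a ha b hb hne
    omega
  by_cases h1 : ∃ s ∈ U ∪ L, T.bit s 1 = true
  · by_cases h2 : ∃ s ∈ U ∪ L, T.bit s 1 = false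
    · have := B.card_le_of_split hd hU hL hUne hLne h2 h1 hk hk (fun _ => hUk)
        fun h => (hone h).trans (by omega)
      omega
    · push Not at h2
      have := hone fun a ha => by simpa using h2 a (Finset.mem_union_right _ ha)
      omega
  · push Not at h1
    have : L.card ≤ k := by
      refine B.card_lower_le subset_rfl (lo := 2) (hi := T.h)
        (fun a ha b hb hab => ⟨?_, hL a ha b hb hab⟩) (Or.inl le_rfl) fun a ha => ?_
      · have ha' := Finset.mem_union_right U ha
        have hb' := Finset.mem_union_right U hb
        refine lt_d_of_bit hab (hd a ha' b hb' hab) ?_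
        have e1 := h1 a ha'
        have e2 := h1 b hb'
        simp only [ne_eq, Bool.not_eq_true] at e1 e2
        rw [e1, e2]
      · have ha' := Finset.mem_union_right U ha
        have e1 := H.zeros_false a (h0 a ha')
        have e2 := h1 a ha'
        rw [← dual_ones] at e1 ⊢
        rcases Nat.lt_or_ge 1 T.h with hh | hh
        · have := T.dual.ones_succ_lt_of_bit_true (a := a) (lo := 1) (hi := T.h)
            (by simpa using e2) hh
          rw [one_add_one_eq_two] at this
          omega
        · have := H.two_le_h
          omega
    omega

/-- In a balanced pattern, a cell has at most `N` sides. -/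
theorem Bounds.card_le_of_balanced (B : T.Bounds U L x) (H : T.Balanced n k p q) {N : ℕ}
    (hp0 : k + 1 + p false ≤ N) (hp1 : k + p true ≤ N) (hq1 : k + 1 + q true ≤ N)
    (hq0 : k + q false ≤ N) (hpq : ∀ b, p b + q b + 1 ≤ N) (hqp : q false + p true ≤ N)
    (hk : 2 * k ≤ N) : U.card + L.card ≤ N := by
  classical
  rcases U.eq_empty_or_nonempty with rfl | hUne
  · simpa using B.card_lower_le_of_balanced H hq1 hq0
  rcases L.eq_empty_or_nonempty with rfl | hLne
  · simpa using B.card_upper_le_of_balanced H hp0 hp1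
  have hh := H.two_le_h
  obtain ⟨i, hi, hmin⟩ := U.exists_min_image T.m hUne
  obtain ⟨j, hj, hmax⟩ := L.exists_max_image T.m hLne
  have hne : j ≠ i := by rintro rfl; exact Finset.disjoint_left.1 B.disj hi hj
  by_cases hij : T.m j < T.m i ∨ T.h ≤ T.d j i
  · have key := B.card_le_of_rightOpen hi hj hmin hmax hij
    have h1 := B.card_bundle_upper_le H i
    have h2 := B.card_bundle_lower_le H j
    have h3 := hpq (T.bit i 0)
    by_cases hb : T.bit j 0 = T.bit i 0
    · rw [hb] at h2
      omega
    · have hd0 : T.d j i = 0 := by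
        by_contra hcon
        exact hb (T.bit_agree j i 0 (by omega))
      have hm : T.m j < T.m i := hij.resolve_right (by omega)
      have h4 := T.bit_left j i hm
      have h5 := T.bit_right j i hm
      rw [hd0] at h4 h5
      rw [h4] at h2
      rw [h5] at h1
      have := key.2 hd0
      omega
  · push Not at hij
    have hm : T.m i < T.m j := (T.m_lt_or_lt hne).resolve_left hij.1.not_gt
    have hU := B.d_lt_of_crossed hi hj hmin hm (by rw [T.d_comm]; exact hij.2)
    have hL := B.dual.d_lt_of_crossed hj hi (fun a ha => neg_le_neg (hmax a ha)) (neg_lt_neg hm)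
      hij.2
    refine le_trans ?_ hk
    by_cases h1 : ∃ s ∈ U ∪ L, T.bit s 0 = true
    · by_cases h0 : ∃ s ∈ U ∪ L, T.bit s 0 = false
      · have := B.card_le_of_split (u := k) (l := k) (fun _ _ _ _ _ => Nat.zero_le _) hU hL hUne
          hLne h0 h1 H.two_le H.two_le ?_ ?_
        · omega
        · intro h
          exact B.card_upper_le subset_rfl (lo := 1) (hi := T.h) (fun a ha b hb hab =>
            ⟨lt_d_of_bit hab (Nat.zero_le _) ((h a ha).trans (h b hb).symm), hU a ha b hb hab⟩)
            (Or.inl le_rfl) fun a ha => H.ones_false a (h a ha)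
        · intro h
          exact B.card_lower_le subset_rfl (lo := 1) (hi := T.h) (fun a ha b hb hab =>
            ⟨lt_d_of_bit hab (Nat.zero_le _) ((h a ha).trans (h b hb).symm), hL a ha b hb hab⟩)
            (Or.inl le_rfl) fun a ha => H.zeros_true a (h a ha)
      · push Not at h0
        have := B.dual.card_le_of_bit_false H.dual hL hU hLne hUne fun a ha => by
          have := h0 a (by rwa [Finset.union_comm])
          simpa using this
        omega
    · push Not at h1
      exact B.card_le_of_bit_false H hU hL hUne hLne fun a ha => by simpa using h1 a ha

end CrossingPattern

/-! ### Graphs of affine functions as lines -/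

/-- The line `y = m x - c`. -/
def graphLine (m c : ℝ) : Flat := AffineSubspace.mk' ((0, -c) : ℝ × ℝ) (Submodule.span ℝ {(1, m)})

theorem mem_graphLine {m c : ℝ} {z : ℝ × ℝ} : z ∈ graphLine m c ↔ z.2 = m * z.1 - c := by
  rw [graphLine, AffineSubspace.mem_mk', Submodule.mem_span_singleton]
  constructor
  · rintro ⟨t, ht⟩
    have h1 := congrArg Prod.fst ht
    have h2 := congrArg Prod.snd ht
    simp at h1 h2
    rw [← h1]; linarith
  · intro h
    refine ⟨z.1, ?_⟩
    ext
    · simp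
    · simp [h]; ring

theorem direction_graphLine (m c : ℝ) :
    (graphLine m c).direction = Submodule.span ℝ {((1, m) : ℝ × ℝ)} := by
  simp [graphLine]

theorem isLine_graphLine (m c : ℝ) : IsLine (graphLine m c) := by
  rw [IsLine, direction_graphLine]
  exact finrank_span_singleton (by simp)

theorem not_isVertical_graphLine (m c : ℝ) : ¬ IsVertical (graphLine m c) := by
  rw [IsVertical, direction_graphLine, Submodule.mem_span_singleton]
  rintro ⟨t, ht⟩
  have h1 := congrArg Prod.fst ht
  have h2 := congrArg Prod.snd ht
  simp at h1 h2
  rw [h1] at h2; simp at h2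

theorem slope_eq_of_parallel {m c m' c' : ℝ} (h : (graphLine m c).Parallel (graphLine m' c')) :
    m = m' := by
  have hd := h.direction_eq
  rw [direction_graphLine, direction_graphLine] at hd
  have : ((1, m) : ℝ × ℝ) ∈ Submodule.span ℝ {((1, m') : ℝ × ℝ)} :=
    hd ▸ Submodule.mem_span_singleton_self _
  obtain ⟨t, ht⟩ := Submodule.mem_span_singleton.1 this
  have h1 := congrArg Prod.fst ht
  have h2 := congrArg Prod.snd ht
  simp at h1 h2
  rw [← h2, h1, one_mul]

/-! ### Sides of cells -/

/-- A continuous function that is positive at a point of a preconnected set and has no zero in that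
set is nonnegative on the frontier of the set. -/
theorem nonneg_on_frontier {P : Set (ℝ × ℝ)} (hP : IsPreconnected P) {g : ℝ × ℝ → ℝ}
    (hg : Continuous g) (h0 : ∀ z ∈ P, g z ≠ 0) {x₀ : ℝ × ℝ} (hx : x₀ ∈ P) (hpos : 0 < g x₀)
    {z : ℝ × ℝ} (hz : z ∈ frontier P) : 0 ≤ g z := by
  have hPpos : P ⊆ {z | 0 ≤ g z} := by
    intro w hw
    by_contra hneg
    obtain ⟨v, hv, hv0⟩ := hP.intermediate_value hw hx hg.continuousOn
      ⟨(not_le.1 hneg).le, hpos.le⟩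
    exact h0 v hv hv0
  exact closure_minimal hPpos (isClosed_le continuous_const hg) (frontier_subset_closure hz)

/-- If every line of a family of graphs contributes a side to a cell, then each of the lines has a
point that lies strictly on the same side of every other line as the cell. -/
theorem exists_point_of_isSide {ι : Type*} {m c : ι → ℝ} (hm : Function.Injective m)
    {G : Finset Flat} {x₀ : ℝ × ℝ} (hx : x₀ ∈ complementOfUnion G) {a : ι}
    (ha : IsSide (connectedComponentIn (complementOfUnion G) x₀) (graphLine (m a) (c a))) :
    ∃ x : ℝ, ∀ b, graphLine (m b) (c b) ∈ G → b ≠ a →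
      (x₀.2 < m b * x₀.1 - c b → m a * x - c a < m b * x - c b) ∧
      (¬ x₀.2 < m b * x₀.1 - c b → m b * x - c b < m a * x - c a) := by
  obtain ⟨v, w, hvw, hseg⟩ := ha
  obtain ⟨hv, hva⟩ := hseg (left_mem_segment ℝ v w)
  obtain ⟨hw, hwa⟩ := hseg (right_mem_segment ℝ v w)
  have hva : v.2 = m a * v.1 - c a := mem_graphLine.1 hva
  have hwa : w.2 = m a * w.1 - c a := mem_graphLine.1 hwa
  have hne : v.1 ≠ w.1 := fun h => hvw (Prod.ext h (by rw [hva, hwa, h]))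
  -- At `v` and `w` the line `a` lies weakly on the correct side of `b`; it cannot meet `b` twice, so
  -- it lies strictly on that side at the midpoint.
  refine ⟨(v.1 + w.1) / 2, fun b hb hba => ?_⟩
  have h0 : ∀ z ∈ connectedComponentIn (complementOfUnion G) x₀, m b * z.1 - c b - z.2 ≠ 0 := by
    intro z hz h
    have hzc := connectedComponentIn_subset _ _ hz
    refine hzc (Set.mem_biUnion hb ?_)
    exact mem_graphLine.2 (by linarith)
  have hx' := mem_connectedComponentIn hx
  have hpre : IsPreconnected (connectedComponentIn (complementOfUnion G) x₀) :=
    isPreconnected_connectedComponentIn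
  have hslope : m b - m a ≠ 0 := sub_ne_zero.2 fun h => hba (hm h)
  have hdist : (m b - m a) * v.1 ≠ (m b - m a) * w.1 := fun h => hne (mul_left_cancel₀ hslope h)
  constructor
  · intro hb0
    have e1 := nonneg_on_frontier hpre (g := fun z => m b * z.1 - c b - z.2) (by fun_prop) h0 hx'
      (by linarith) hv
    have e2 := nonneg_on_frontier hpre (g := fun z => m b * z.1 - c b - z.2) (by fun_prop) h0 hx'
      (by linarith) hw
    simp only [hva, hwa] at e1 e2
    rcases lt_or_gt_of_ne hdist with h | h <;> linarith
  · intro hb0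
    have hb1 : 0 < -(m b * x₀.1 - c b - x₀.2) := by
      have := h0 x₀ hx'
      rcases lt_or_gt_of_ne this with h | h <;> linarith
    have h0' : ∀ z ∈ connectedComponentIn (complementOfUnion G) x₀,
        -(m b * z.1 - c b - z.2) ≠ 0 := fun z hz => neg_ne_zero.2 (h0 z hz)
    have e1 := nonneg_on_frontier hpre (g := fun z => -(m b * z.1 - c b - z.2)) (by fun_prop) h0'
      hx' hb1 hv
    have e2 := nonneg_on_frontier hpre (g := fun z => -(m b * z.1 - c b - z.2)) (by fun_prop) h0'
      hx' hb1 hw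
    simp only [hva, hwa] at e1 e2
    rcases lt_or_gt_of_ne hdist with h | h <;> linarith

namespace CrossingPattern

variable {ι : Type*} {T : CrossingPattern ι} {c : ι → ℝ}

theorem X_ne {a b e : ι} (hab : T.m a < T.m b) (hbe : T.m b < T.m e) : T.X a b ≠ T.X b e := by
  have hne : T.d a b ≠ T.d b e := by rcases ultrametric hab hbe with h | h <;> omega
  have h1 := ne_of_m_lt hab
  have h2 := ne_of_m_lt hbe
  rcases Nat.lt_or_ge (T.d a b) T.h with h3 | h3 <;> rcases Nat.lt_or_ge (T.d b e) T.h with h4 | h4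
  · rcases lt_or_gt_of_ne hne with h | h
    · exact (T.X_lt_of_deeper b e a b h2 h1 h (Or.inl h4)).ne'
    · exact (T.X_lt_of_deeper a b b e h1 h2 h (Or.inl h3)).ne
  · exact (T.X_lt_of_bundle b e a b h2 h1 h3 h4).ne
  · exact (T.X_lt_of_bundle a b b e h1 h2 h4 h3).ne'
  · rcases lt_or_gt_of_ne hne with h | h
    · exact (T.X_lt_of_deeper b e a b h2 h1 h (Or.inr h3)).ne'
    · exact (T.X_lt_of_deeper a b b e h1 h2 h (Or.inr h4)).ne

variable (T) in
/-- The lines `y = m a x - c a` cross at the abscissas prescribed by the pattern. -/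
def IsRealizedBy (c : ι → ℝ) : Prop :=
  ∀ a b, T.m a < T.m b → (T.m b - T.m a) * T.X a b = c b - c a

theorem graphLine_injective : Function.Injective fun a => graphLine (T.m a) (c a) := by
  intro a b hab
  have hab' : graphLine (T.m a) (c a) = graphLine (T.m b) (c b) := hab
  exact T.m_inj a b (slope_eq_of_parallel (by rw [hab']))

theorem IsRealizedBy.lt_X (hc : T.IsRealizedBy c) {a b : ι} (hab : T.m a < T.m b) {x : ℝ}
    (h : T.m b * x - c b < T.m a * x - c a) : x < T.X a b := by
  have := hc a b hab
  exact lt_of_mul_lt_mul_left (a := T.m b - T.m a) (by linarith) (by linarith)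

theorem IsRealizedBy.X_lt (hc : T.IsRealizedBy c) {a b : ι} (hab : T.m a < T.m b) {x : ℝ}
    (h : T.m a * x - c a < T.m b * x - c b) : T.X a b < x := by
  have := hc a b hab
  exact lt_of_mul_lt_mul_left (a := T.m b - T.m a) (by linarith) (by linarith)

variable [Fintype ι]

variable (T) in
/-- The lines of a pattern realized by the intercepts `c`. -/
noncomputable def lines (c : ι → ℝ) : Finset Flat := by
  classical exact Finset.univ.image fun a => graphLine (T.m a) (c a)

theorem mem_lines {l : Flat} : l ∈ T.lines c ↔ ∃ a, graphLine (T.m a) (c a) = l := by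
  simp [lines]

theorem card_lines : (T.lines c).card = Fintype.card ι := by
  classical
  rw [lines, Finset.card_image_of_injective _ graphLine_injective, Finset.card_univ]

theorem IsRealizedBy.inGeneralPosition (hc : T.IsRealizedBy c) :
    InGeneralPosition (T.lines c) where
  isLine l hl := by
    obtain ⟨a, rfl⟩ := mem_lines.1 hl
    exact isLine_graphLine _ _
  not_vertical l hl := by
    obtain ⟨a, rfl⟩ := mem_lines.1 hl
    exact not_isVertical_graphLine _ _
  not_parallel l hl l' hl' hne hpar := by
    obtain ⟨a, rfl⟩ := mem_lines.1 hl
    obtain ⟨b, rfl⟩ := mem_lines.1 hl'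
    exact hne (by rw [T.m_inj a b (slope_eq_of_parallel hpar)])
  not_concurrent l hl l' hl' l'' hl'' h1 h2 h3 := by
    obtain ⟨a, rfl⟩ := mem_lines.1 hl
    obtain ⟨b, rfl⟩ := mem_lines.1 hl'
    obtain ⟨e, rfl⟩ := mem_lines.1 hl''
    rintro ⟨z, hza, hzb, hze⟩
    rw [mem_graphLine] at hza hzb hze
    have key : ∀ a b e : ι, T.m a < T.m b → T.m b < T.m e → z.2 = T.m a * z.1 - c a →
        z.2 = T.m b * z.1 - c b → z.2 = T.m e * z.1 - c e → False := by
      intro a b e hab hbe ha hb he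
      have e1 := hc a b hab
      have e2 := hc b e hbe
      refine X_ne hab hbe ?_
      have f1 : T.X a b = z.1 := mul_left_cancel₀ (sub_pos.2 hab).ne' (by rw [e1]; linarith)
      have f2 : T.X b e = z.1 := mul_left_cancel₀ (sub_pos.2 hbe).ne' (by rw [e2]; linarith)
      rw [f1, f2]
    have hab : a ≠ b := fun h => h1 (by rw [h])
    have hae : a ≠ e := fun h => h2 (by rw [h])
    have hbe : b ≠ e := fun h => h3 (by rw [h])
    rcases T.m_lt_or_lt hab with h | h <;> rcases T.m_lt_or_lt hae with h' | h' <;>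
      rcases T.m_lt_or_lt hbe with h'' | h''
    · exact key a b e h h'' hza hzb hze
    · exact key a e b h' h'' hza hze hzb
    · exact absurd (h.trans h'') h'.not_gt
    · exact key e a b h' h hze hza hzb
    · exact key b a e h h' hzb hza hze
    · exact absurd (h'.trans h'') h.not_gt
    · exact key b e a h'' h' hzb hze hza
    · exact key e b a h'' h hze hzb hza

/-- Lines in convex position split into the upper and the lower sides of a cell. -/
theorem IsRealizedBy.exists_bounds (hc : T.IsRealizedBy c) {n : ℕ} (h : SpansCell (T.lines c) n) :
    ∃ U L x, T.Bounds U L x ∧ U.card + L.card = n := by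
  classical
  obtain ⟨G, hGF, hGn, P, ⟨x₀, hx₀, rfl⟩, hcard⟩ := h
  have hside : ∀ l ∈ G, IsSide (connectedComponentIn (complementOfUnion G) x₀) l := by
    have hsub : {l : Flat | l ∈ G ∧ IsSide (connectedComponentIn (complementOfUnion G) x₀) l} ⊆
        (G : Set Flat) := fun l hl => hl.1
    have := Set.eq_of_subset_of_ncard_le hsub (by rw [hcard, Set.ncard_coe_finset])
    intro l hl
    have hl' : l ∈ (G : Set Flat) := hl
    rw [← this] at hl'
    exact hl'.2
  have hinj : Function.Injective T.m := fun a b => T.m_inj a b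
  set S : Finset ι := Finset.univ.filter fun a => graphLine (T.m a) (c a) ∈ G with hS
  have hSG : ∀ a, a ∈ S ↔ graphLine (T.m a) (c a) ∈ G := by simp [hS]
  have hScard : S.card = n := by
    rw [← hGn]
    refine Finset.card_bij (fun a _ => graphLine (T.m a) (c a)) (fun a ha => (hSG a).1 ha)
      (fun a _ b _ hab => graphLine_injective hab) fun l hl => ?_
    obtain ⟨a, rfl⟩ := mem_lines.1 (hGF hl)
    exact ⟨a, (hSG a).2 hl, rfl⟩
  have hx : ∀ a ∈ S, ∃ x : ℝ, ∀ b ∈ S, b ≠ a →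
      (x₀.2 < T.m b * x₀.1 - c b → T.m a * x - c a < T.m b * x - c b) ∧
      (¬ x₀.2 < T.m b * x₀.1 - c b → T.m b * x - c b < T.m a * x - c a) := by
    intro a ha
    obtain ⟨x, hx⟩ := exists_point_of_isSide hinj hx₀ (hside _ ((hSG a).1 ha))
    exact ⟨x, fun b hb => hx b ((hSG b).1 hb)⟩
  choose! x hx using hx
  refine ⟨S.filter fun b => x₀.2 < T.m b * x₀.1 - c b,
    S.filter fun b => ¬ x₀.2 < T.m b * x₀.1 - c b, x, ?_, ?_⟩
  · refine ⟨Finset.disjoint_filter_filter_not _ _ _, ?_, ?_, ?_, ?_⟩ <;>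
      intro a ha b hb hab <;> rw [Finset.mem_filter] at ha hb <;>
      have hne := ne_of_m_lt hab <;>
      have ha' := hx b hb.1 a ha.1 hne <;> have hb' := hx a ha.1 b hb.1 hne.symm
    · exact ⟨hc.lt_X hab (ha'.1 ha.2), hc.X_lt hab (hb'.1 hb.2)⟩
    · exact ⟨hc.lt_X hab (hb'.2 hb.2), hc.X_lt hab (ha'.2 ha.2)⟩
    · exact ⟨hc.X_lt hab (hb'.1 hb.2), hc.X_lt hab (ha'.2 ha.2)⟩
    · exact ⟨hc.lt_X hab (hb'.2 hb.2), hc.lt_X hab (ha'.1 ha.2)⟩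
  · rw [Finset.card_filter_add_card_filter_not, hScard]

end CrossingPattern

/-! ### Lines from binary words -/

/-- If the coefficients of a polynomial in a small `ε` vanish below `r`, then its value is governed
by the coefficient at `r`. -/
theorem abs_sum_sub_le {f : ℕ → ℝ} {n r : ℕ} {K ε : ℝ} (hε : 0 < ε) (hε2 : ε ≤ 1 / 2) (hr : r < n)
    (hf : ∀ e < n, |f e| ≤ K) (h0 : ∀ e < r, f e = 0) :
    |∑ e ∈ Finset.range n, f e * ε ^ e - f r * ε ^ r| ≤ 2 * K * ε ^ (r + 1) := by
  have hK : 0 ≤ K := (abs_nonneg _).trans (hf r hr)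
  -- the geometric tail is at most twice its first term since `ε ≤ 1 / 2`
  suffices H : ∀ l, r < l → l ≤ n →
      |∑ e ∈ Finset.range l, f e * ε ^ e - f r * ε ^ r| ≤ 2 * K * (ε ^ (r + 1) - ε ^ l) by
    refine (H n hr le_rfl).trans ?_
    have : 0 < ε ^ n := by positivity
    exact mul_le_mul_of_nonneg_left (by linarith) (by positivity)
  intro l hl
  induction l, hl using Nat.le_induction with
  | base =>
    intro _
    have : ∑ e ∈ Finset.range r, f e * ε ^ e = 0 :=
      Finset.sum_eq_zero fun e he => by rw [h0 e (Finset.mem_range.1 he), zero_mul]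
    rw [Finset.sum_range_succ, this]
    simp
  | succ l hl ih =>
    intro hln
    have hl' := ih (by omega)
    have hfl : |f l * ε ^ l| ≤ K * ε ^ l := by
      rw [abs_mul, abs_of_pos (pow_pos hε l)]
      exact mul_le_mul_of_nonneg_right (hf l (by omega)) (by positivity)
    have hge : K * ε ^ l ≤ 2 * K * (ε ^ l - ε ^ (l + 1)) := by
      have h1 : 0 ≤ K * ε ^ l := by positivity
      have h2 : K * ε ^ l * ε ≤ K * ε ^ l * (1 / 2) := mul_le_mul_of_nonneg_left hε2 h1
      rw [pow_succ]; linarith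
    rw [Finset.sum_range_succ]
    calc _ = |(∑ e ∈ Finset.range l, f e * ε ^ e - f r * ε ^ r) + f l * ε ^ l| := by
          congr 1; ring
      _ ≤ _ := abs_add_le _ _
      _ ≤ 2 * K * (ε ^ (r + 1) - ε ^ (l + 1)) := by linarith

/-- The value at `ε` of the polynomial whose coefficients are those of `f` at the ones of `w`. -/
noncomputable def wordSum (ε : ℝ) (f : ℕ → ℝ) (w : Finset ℕ) : ℝ := ∑ e ∈ w, f e * ε ^ e

theorem wordSum_eq {n : ℕ} {w : Finset ℕ} (hw : w ⊆ Finset.range n) (ε : ℝ) (f : ℕ → ℝ) :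
    wordSum ε f w = ∑ e ∈ Finset.range n, (if e ∈ w then f e else 0) * ε ^ e := by
  simp only [ite_mul, zero_mul]
  rw [Finset.sum_ite_mem, Finset.inter_eq_right.2 hw, wordSum]

theorem wordSum_sub_const (ε θ : ℝ) (f : ℕ → ℝ) (w : Finset ℕ) :
    wordSum ε (fun e => f e - θ) w = wordSum ε f w - θ * wordSum ε (fun _ => 1) w := by
  simp only [wordSum, sub_mul, Finset.sum_sub_distrib, Finset.mul_sum, one_mul]

/-- The first position at which two words, given as sets of positions of ones, differ. -/
noncomputable def firstDiff (a b : Finset ℕ) : ℕ := sInf {e | ¬ (e ∈ a ↔ e ∈ b)}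

theorem firstDiff_comm (a b : Finset ℕ) : firstDiff a b = firstDiff b a := by
  simp only [firstDiff, iff_comm]

theorem firstDiff_spec {a b : Finset ℕ} (hab : a ≠ b) :
    ¬ (firstDiff a b ∈ a ↔ firstDiff a b ∈ b) := by
  have : {e | ¬ (e ∈ a ↔ e ∈ b)}.Nonempty := by
    by_contra hcon
    rw [Set.not_nonempty_iff_eq_empty] at hcon
    refine hab (Finset.ext fun e => ?_)
    by_contra he
    exact Set.notMem_empty e (hcon ▸ he)
  exact Nat.sInf_mem this

theorem mem_iff_of_lt_firstDiff {a b : Finset ℕ} {e : ℕ} (he : e < firstDiff a b) :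
    e ∈ a ↔ e ∈ b := by
  have := Nat.notMem_of_lt_sInf he
  simpa using this

theorem firstDiff_lt {a b : Finset ℕ} {n : ℕ} (ha : a ⊆ Finset.range n) (hb : b ⊆ Finset.range n)
    (hab : a ≠ b) : firstDiff a b < n := by
  have := firstDiff_spec hab
  by_cases h : firstDiff a b ∈ a
  · exact Finset.mem_range.1 (ha h)
  · exact Finset.mem_range.1 (hb (by tauto))

theorem wordSum_lt {a b : Finset ℕ} {n : ℕ} (ha : a ⊆ Finset.range n) (hb : b ⊆ Finset.range n)
    (hra : firstDiff a b ∉ a) (hrb : firstDiff a b ∈ b) {ε K : ℝ} (hε : 0 < ε) (hε2 : ε ≤ 1 / 2)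
    {f : ℕ → ℝ} (hf : ∀ e < n, |f e| ≤ K) (hr : 2 * K * ε < f (firstDiff a b)) :
    wordSum ε f a < wordSum ε f b := by
  have hrn : firstDiff a b < n := Finset.mem_range.1 (hb hrb)
  have hK : 0 ≤ K := (abs_nonneg _).trans (hf _ hrn)
  have key := abs_sum_sub_le (f := fun e => (if e ∈ b then f e else 0) - (if e ∈ a then f e else 0))
    hε hε2 hrn (K := K) ?_ ?_
  · simp only [hra, hrb, if_true, if_false, sub_zero, sub_mul, Finset.sum_sub_distrib] at key
    rw [← wordSum_eq ha, ← wordSum_eq hb] at key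
    have h1 := (abs_le.1 key).1
    have h2 : 2 * K * ε * ε ^ firstDiff a b < f (firstDiff a b) * ε ^ firstDiff a b :=
      mul_lt_mul_of_pos_right hr (by positivity)
    rw [pow_succ] at h1
    linarith
  · intro e he
    have := hf e he
    split_ifs <;> simp [hK, this]
  · intro e he
    simp [mem_iff_of_lt_firstDiff he]

/-- The abscissa near which two lines with first difference at position `e` cross. -/
noncomputable def targetAbscissa (n h e : ℕ) : ℝ := if e < h then -(e : ℝ) else (n : ℝ) - e

theorem abs_targetAbscissa_le {n h e : ℕ} (he : e < n) : |targetAbscissa n h e| ≤ n := by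
  have h1 : (e : ℝ) < n := by exact_mod_cast he
  have h2 : (0 : ℝ) ≤ e := by positivity
  rw [abs_le, targetAbscissa]
  split_ifs <;> constructor <;> linarith

theorem targetAbscissa_deeper {n h e e' : ℕ} (he : e' < e) (hh : e < h ∨ h ≤ e') :
    targetAbscissa n h e + 1 ≤ targetAbscissa n h e' := by
  have h1 : (e' : ℝ) + 1 ≤ e := by exact_mod_cast he
  rcases hh with hh | hh
  · rw [targetAbscissa, targetAbscissa, if_pos hh, if_pos (he.trans hh)]; linarith
  · rw [targetAbscissa, targetAbscissa, if_neg (by omega), if_neg (by omega)]; linarith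

theorem targetAbscissa_bundle {n h e e' : ℕ} (hen : e < n) (h1 : e' < h) (h2 : h ≤ e) :
    targetAbscissa n h e' + 1 ≤ targetAbscissa n h e := by
  rw [targetAbscissa, targetAbscissa, if_pos h1, if_neg (by omega)]
  have h3 : (e : ℝ) + 1 ≤ n := by exact_mod_cast hen
  have h4 : (0 : ℝ) ≤ e' := by positivity
  linarith

section WordPattern

/-- The small ratio of the slopes attached to successive positions. -/
noncomputable def ratio (n : ℕ) : ℝ := 1 / (8 * (n + 1))

theorem ratio_pos (n : ℕ) : 0 < ratio n := by unfold ratio; positivity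

theorem ratio_mul (n : ℕ) : 8 * (n + 1) * ratio n = 1 := by
  unfold ratio; field_simp

theorem ratio_le (n : ℕ) : ratio n ≤ 1 / 8 := by
  have h1 := ratio_mul n
  have h2 : 0 ≤ n * ratio n := by have := ratio_pos n; positivity
  linarith

/-- The slope of the line of a word. -/
noncomputable def wordSlope (n : ℕ) (w : Finset ℕ) : ℝ := wordSum (ratio n) (fun _ => 1) w

/-- Minus the ordinate at the origin of the line of a word. -/
noncomputable def wordIntercept (n h : ℕ) (w : Finset ℕ) : ℝ :=
  wordSum (ratio n) (targetAbscissa n h) w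

/-- The abscissa at which the lines of two words cross. -/
noncomputable def wordCrossing (n h : ℕ) (a b : Finset ℕ) : ℝ :=
  (wordIntercept n h b - wordIntercept n h a) / (wordSlope n b - wordSlope n a)

theorem wordCrossing_comm (n h : ℕ) (a b : Finset ℕ) :
    wordCrossing n h a b = wordCrossing n h b a := by
  rw [wordCrossing, ← neg_div_neg_eq, neg_sub, neg_sub, wordCrossing]

variable {n h : ℕ} {a b : Finset ℕ}

theorem wordSlope_lt (ha : a ⊆ Finset.range n) (hb : b ⊆ Finset.range n)
    (hra : firstDiff a b ∉ a) (hrb : firstDiff a b ∈ b) : wordSlope n a < wordSlope n b := by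
  have := ratio_le n
  exact wordSum_lt ha hb hra hrb (ratio_pos n) (by linarith) (K := 1) (by simp) (by linarith)

theorem wordSlope_lt_iff (ha : a ⊆ Finset.range n) (hb : b ⊆ Finset.range n) :
    wordSlope n a < wordSlope n b ↔ a ≠ b ∧ firstDiff a b ∉ a ∧ firstDiff a b ∈ b := by
  constructor
  · intro hlt
    have hab : a ≠ b := by rintro rfl; exact lt_irrefl _ hlt
    have := firstDiff_spec hab
    by_cases h : firstDiff a b ∈ a
    · have hb' : firstDiff a b ∉ b := by tauto
      rw [firstDiff_comm] at h hb'
      exact absurd (wordSlope_lt hb ha hb' h) hlt.not_gt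
    · tauto
  · exact fun h => wordSlope_lt ha hb h.2.1 h.2.2

theorem wordSlope_injOn (ha : a ⊆ Finset.range n) (hb : b ⊆ Finset.range n)
    (hab : wordSlope n a = wordSlope n b) : a = b := by
  by_contra hne
  have := firstDiff_spec hne
  by_cases h : firstDiff a b ∈ a
  · have hb' : firstDiff a b ∉ b := by tauto
    rw [firstDiff_comm] at h hb'
    exact absurd hab (wordSlope_lt hb ha hb' h).ne'
  · exact absurd hab (wordSlope_lt ha hb h (by tauto)).ne

/-- The crossing of two lines lies within distance `1 / 2` of its target. -/
theorem abs_wordCrossing_sub_lt (ha : a ⊆ Finset.range n) (hb : b ⊆ Finset.range n) (hab : a ≠ b) :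
    |wordCrossing n h a b - targetAbscissa n h (firstDiff a b)| < 1 / 2 := by
  wlog hra : firstDiff a b ∉ a generalizing a b
  · have hspec := firstDiff_spec hab
    rw [wordCrossing_comm, firstDiff_comm]
    exact this hb ha hab.symm (by rw [firstDiff_comm]; tauto)
  have hrb : firstDiff a b ∈ b := by have := firstDiff_spec hab; tauto
  have hrn := firstDiff_lt ha hb hab
  have hpos := sub_pos.2 (wordSlope_lt ha hb hra hrb)
  have hε := ratio_pos n
  have hε8 := ratio_le n
  have hmul := ratio_mul n
  set τ := targetAbscissa n h (firstDiff a b) with hτ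
  have hτn : |τ| ≤ n := abs_targetAbscissa_le hrn
  have hbound : ∀ θ : ℝ, |θ - τ| ≤ 1 / 2 → ∀ e < n, |targetAbscissa n h e - θ| ≤ 2 * n + 1 := by
    intro θ hθ e he
    have h1 := abs_le.1 (abs_targetAbscissa_le (h := h) he)
    have h2 := abs_le.1 hθ
    have h3 := abs_le.1 hτn
    rw [abs_le]; constructor <;> linarith
  rw [abs_sub_lt_iff]
  constructor
  · have hlt := wordSum_lt ha hb hra hrb hε (by linarith) (K := 2 * n + 1)
      (f := fun e => -(targetAbscissa n h e - (τ + 1 / 2)))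
      (fun e he => by rw [abs_neg]; exact hbound _ (by norm_num) e he)
      (by rw [← hτ]; linarith)
    have hneg : ∀ w, wordSum (ratio n) (fun e => -(targetAbscissa n h e - (τ + 1 / 2))) w =
        -wordSum (ratio n) (fun e => targetAbscissa n h e - (τ + 1 / 2)) w := by
      intro w; simp only [wordSum, neg_mul, Finset.sum_neg_distrib]
    rw [hneg, hneg, wordSum_sub_const, wordSum_sub_const] at hlt
    rw [sub_lt_iff_lt_add', wordCrossing, div_lt_iff₀ hpos]
    simp only [wordIntercept, wordSlope]
    linarith
  · have hlt := wordSum_lt ha hb hra hrb hε (by linarith) (K := 2 * n + 1)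
      (f := fun e => targetAbscissa n h e - (τ - 1 / 2))
      (fun e he => hbound _ (by norm_num) e he)
      (by rw [← hτ]; linarith)
    rw [wordSum_sub_const, wordSum_sub_const] at hlt
    rw [sub_lt_comm, wordCrossing, lt_div_iff₀ hpos]
    simp only [wordIntercept, wordSlope]
    linarith

/-- The abscissas at which three lines cross pairwise: the crossing of the extreme slopes lies
between the other two. -/
theorem div_mediant {C₁ C₂ M₁ M₂ : ℝ} (h₁ : 0 < M₁) (h₂ : 0 < M₂) :
    (C₁ / M₁ < (C₁ + C₂) / (M₁ + M₂) ↔ C₁ * M₂ < C₂ * M₁) ∧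
    ((C₁ + C₂) / (M₁ + M₂) < C₂ / M₂ ↔ C₁ * M₂ < C₂ * M₁) ∧
    (C₂ / M₂ < (C₁ + C₂) / (M₁ + M₂) ↔ C₂ * M₁ < C₁ * M₂) ∧
    ((C₁ + C₂) / (M₁ + M₂) < C₁ / M₁ ↔ C₂ * M₁ < C₁ * M₂) := by
  have h := add_pos h₁ h₂
  refine ⟨?_, ?_, ?_, ?_⟩ <;> rw [div_lt_div_iff₀ (by assumption) (by assumption)] <;>
    constructor <;> intro <;> linarith

/-- The crossing pattern of the lines of a set of words. -/
noncomputable def wordPattern (n h : ℕ) (W : Finset (Finset ℕ))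
    (hW : ∀ w ∈ W, w ⊆ Finset.range n) : CrossingPattern W where
  m w := wordSlope n w
  X a b := wordCrossing n h a b
  d a b := firstDiff (a : Finset ℕ) b
  bit w e := decide (e ∈ (w : Finset ℕ))
  h := h
  m_inj a b hab := Subtype.ext (wordSlope_injOn (hW a a.2) (hW b b.2) hab)
  X_comm a b := wordCrossing_comm n h a b
  d_comm a b := firstDiff_comm _ _
  bit_left a b hab := by simpa using ((wordSlope_lt_iff (hW a a.2) (hW b b.2)).1 hab).2.1
  bit_right a b hab := by simpa using ((wordSlope_lt_iff (hW a a.2) (hW b b.2)).1 hab).2.2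
  bit_agree a b e he := by simpa using mem_iff_of_lt_firstDiff he
  mediant a b c hab hbc hX := by
    have key := div_mediant (C₁ := wordIntercept n h b - wordIntercept n h a)
      (C₂ := wordIntercept n h c - wordIntercept n h b) (sub_pos.2 hab) (sub_pos.2 hbc)
    rw [sub_add_sub_cancel', sub_add_sub_cancel'] at key
    exact key.2.1.2 (key.1.1 hX)
  mediant' a b c hab hbc hX := by
    have key := div_mediant (C₁ := wordIntercept n h b - wordIntercept n h a)
      (C₂ := wordIntercept n h c - wordIntercept n h b) (sub_pos.2 hab) (sub_pos.2 hbc)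
    rw [sub_add_sub_cancel', sub_add_sub_cancel'] at key
    exact key.2.2.2.2 (key.2.2.1.1 hX)
  X_lt_of_deeper a b c e hab hce hd hh := by
    have h1 := (abs_lt.1 (abs_wordCrossing_sub_lt (h := h) (hW a a.2) (hW b b.2)
      fun h => hab (Subtype.ext h))).2
    have h2 := (abs_lt.1 (abs_wordCrossing_sub_lt (h := h) (hW c c.2) (hW e e.2)
      fun h => hce (Subtype.ext h))).1
    have h3 := targetAbscissa_deeper (n := n) hd hh
    linarith
  X_lt_of_bundle a b c e hab hce h1 h2 := by
    have hab' : (a : Finset ℕ) ≠ b := fun h => hab (Subtype.ext h)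
    have h3 := (abs_lt.1 (abs_wordCrossing_sub_lt (h := h) (hW a a.2) (hW b b.2) hab')).1
    have h4 := (abs_lt.1 (abs_wordCrossing_sub_lt (h := h) (hW c c.2) (hW e e.2)
      fun h => hce (Subtype.ext h))).2
    have h5 := targetAbscissa_bundle (firstDiff_lt (hW a a.2) (hW b b.2) hab') h1 h2
    linarith

theorem wordPattern_isRealizedBy {W : Finset (Finset ℕ)} (hW : ∀ w ∈ W, w ⊆ Finset.range n) :
    (wordPattern n h W hW).IsRealizedBy fun w => wordIntercept n h w := by
  intro a b hab
  exact mul_div_cancel₀ _ (sub_pos.2 hab).ne'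

theorem wordPattern_ones {W : Finset (Finset ℕ)} {hW : ∀ w ∈ W, w ⊆ Finset.range n} (a : W)
    (lo hi : ℕ) :
    (wordPattern n h W hW).ones a lo hi = ((a : Finset ℕ) ∩ Finset.Ico lo hi).card := by
  rw [CrossingPattern.ones, Finset.inter_comm, ← Finset.filter_mem_eq_inter]
  simp [wordPattern]

end WordPattern

theorem CrossingPattern.ones_add_zeros {ι : Type*} (T : CrossingPattern ι) (a : ι) (lo hi : ℕ) :
    T.ones a lo hi + T.zeros a lo hi = hi - lo := by
  have := Finset.card_filter_add_card_filter_not (s := Finset.Ico lo hi)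
    (fun e => T.bit a e = true)
  simpa [ones, zeros] using this

/-! ### The words of the extremal families -/

/-- The names of the bundles with leading letter `β`: words on the positions in `[1, 2k)`. Those
whose first letter is again `β` have `k - 1` ones and `k - 1` zeros at the remaining positions, in
any order. To these is added a single name whose first letter is not `β`, with the same total
numbers of ones and zeros. -/
def bundleNames (k : ℕ) : Bool → Finset (Finset ℕ)
  | false => insert (insert 1 (Finset.Ico 2 k)) (Finset.powersetCard (k - 1) (Finset.Ico 2 (2 * k)))
  | true => insert (Finset.Ico 2 (k + 2))
      ((Finset.powersetCard (k - 1) (Finset.Ico 2 (2 * k))).image (insert 1))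

/-- The words of length `2k + l` formed by a leading letter `β`, the name of a bundle, and a word
of length `l` with `s β` ones. -/
def extremalWords (k l : ℕ) (s : Bool → ℕ) : Finset (Finset ℕ) :=
  (Finset.range (2 * k + l)).powerset.filter fun w =>
    w ∩ Finset.Ico 1 (2 * k) ∈ bundleNames k (decide (0 ∈ w)) ∧
    w ∩ Finset.Ico (2 * k) (2 * k + l) ∈
      Finset.powersetCard (s (decide (0 ∈ w))) (Finset.Ico (2 * k) (2 * k + l))

theorem one_notMem_of_mem_powersetCard {k r : ℕ} {v : Finset ℕ}
    (hv : v ∈ Finset.powersetCard r (Finset.Ico 2 (2 * k))) : 1 ∉ v := fun h => by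
  have := (Finset.mem_powersetCard.1 hv).1 h
  simp at this

theorem card_bundleNames (k : ℕ) (β : Bool) :
    (bundleNames k β).card = Nat.choose (2 * k - 2) (k - 1) + 1 := by
  cases β
  · rw [bundleNames, Finset.card_insert_of_notMem, Finset.card_powersetCard, Nat.card_Ico]
    exact fun h => one_notMem_of_mem_powersetCard h (Finset.mem_insert_self _ _)
  · rw [bundleNames, Finset.card_insert_of_notMem, Finset.card_image_of_injOn,
      Finset.card_powersetCard, Nat.card_Ico]
    · intro v hv w hw hvw
      have := congrArg (fun u : Finset ℕ => u.erase 1) hvw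
      simpa [Finset.erase_insert (one_notMem_of_mem_powersetCard hv),
        Finset.erase_insert (one_notMem_of_mem_powersetCard hw)] using this
    · intro h
      obtain ⟨v, -, hv⟩ := Finset.mem_image.1 h
      have : 1 ∈ Finset.Ico 2 (k + 2) := hv ▸ Finset.mem_insert_self _ _
      simp at this

theorem subset_of_mem_bundleNames {k : ℕ} (hk : 2 ≤ k) {β : Bool} {v : Finset ℕ}
    (hv : v ∈ bundleNames k β) : v ⊆ Finset.Ico 1 (2 * k) := by
  cases β
  · rcases Finset.mem_insert.1 hv with rfl | hv
    · intro e he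
      simp only [Finset.mem_insert, Finset.mem_Ico] at he ⊢
      omega
    · exact (Finset.mem_powersetCard.1 hv).1.trans (Finset.Ico_subset_Ico (by omega) le_rfl)
  · rcases Finset.mem_insert.1 hv with rfl | hv
    · exact Finset.Ico_subset_Ico (by omega) (by omega)
    · obtain ⟨u, hu, rfl⟩ := Finset.mem_image.1 hv
      exact Finset.insert_subset (Finset.mem_Ico.2 (by omega))
        ((Finset.mem_powersetCard.1 hu).1.trans (Finset.Ico_subset_Ico one_le_two le_rfl))

theorem card_of_mem_bundleNames {k : ℕ} (hk : 2 ≤ k) {β : Bool} {v : Finset ℕ}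
    (hv : v ∈ bundleNames k β) : v.card = if β then k else k - 1 := by
  cases β
  · rcases Finset.mem_insert.1 hv with rfl | hv
    · rw [Finset.card_insert_of_notMem (by simp), Nat.card_Ico, if_neg Bool.false_ne_true]
      omega
    · simpa using (Finset.mem_powersetCard.1 hv).2
  · rcases Finset.mem_insert.1 hv with rfl | hv
    · simp
    · obtain ⟨u, hu, rfl⟩ := Finset.mem_image.1 hv
      rw [Finset.card_insert_of_notMem (one_notMem_of_mem_powersetCard hu),
        (Finset.mem_powersetCard.1 hu).2, if_pos rfl]
      omega

/-- The name whose first letter differs from the leading letter is unique. -/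
theorem bundleNames_special {k : ℕ} {β : Bool} {v w : Finset ℕ} (hv : v ∈ bundleNames k β)
    (hw : w ∈ bundleNames k β) (hv1 : decide (1 ∈ v) = !β) (hw1 : decide (1 ∈ w) = !β) :
    v = w := by
  have key : ∀ u ∈ bundleNames k β, decide (1 ∈ u) = (!β) →
      u = bif β then Finset.Ico 2 (k + 2) else insert 1 (Finset.Ico 2 k) := by
    intro u hu hu1
    cases β
    · rcases Finset.mem_insert.1 hu with rfl | hu
      · rfl
      · exact absurd (by simpa using hu1) (one_notMem_of_mem_powersetCard hu)
    · rcases Finset.mem_insert.1 hu with rfl | hu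
      · rfl
      · obtain ⟨v, hv, rfl⟩ := Finset.mem_image.1 hu
        simp at hu1
  rw [key v hv hv1, key w hw hw1]

theorem card_extremalWords {k l : ℕ} (hk : 2 ≤ k) (s : Bool → ℕ) :
    (Nat.choose (2 * k - 2) (k - 1) + 1) * (Nat.choose l (s false) + Nat.choose l (s true)) ≤
      (extremalWords k l s).card := by
  have key : ∀ β : Bool, (Nat.choose (2 * k - 2) (k - 1) + 1) * Nat.choose l (s β) ≤
      ((extremalWords k l s).filter fun w => decide (0 ∈ w) = β).card := by
    intro β
    set B := Finset.powersetCard (s β) (Finset.Ico (2 * k) (2 * k + l)) with hB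
    have hcard : (bundleNames k β ×ˢ B).card =
        (Nat.choose (2 * k - 2) (k - 1) + 1) * Nat.choose l (s β) := by
      rw [Finset.card_product, card_bundleNames k, Finset.card_powersetCard, Nat.card_Ico,
        Nat.add_sub_cancel_left]
    rw [← hcard]
    have hsub : ∀ v ∈ bundleNames k β ×ˢ B, v.1 ⊆ Finset.Ico 1 (2 * k) ∧
        v.2 ⊆ Finset.Ico (2 * k) (2 * k + l) := fun v hv =>
      ⟨subset_of_mem_bundleNames hk (Finset.mem_product.1 hv).1,
        (Finset.mem_powersetCard.1 (Finset.mem_product.1 hv).2).1⟩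
    set g : Finset ℕ × Finset ℕ → Finset ℕ :=
      fun v => ((if β then {0} else ∅) ∪ v.1) ∪ v.2 with hg
    have hmem : ∀ v e, e ∈ g v ↔ (e = 0 ∧ β = true) ∨ e ∈ v.1 ∨ e ∈ v.2 := by
      intro v e
      cases β <;> simp [hg]
    have hzero : ∀ v ∈ bundleNames k β ×ˢ B, decide (0 ∈ g v) = β := by
      intro v hv
      obtain ⟨h1, h2⟩ := hsub v hv
      have h3 : 0 ∉ v.1 := fun h => by have := Finset.mem_Ico.1 (h1 h); omega
      have h4 : 0 ∉ v.2 := fun h => by have := Finset.mem_Ico.1 (h2 h); omega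
      cases β <;> simp [hg, h3, h4]
    have hfst : ∀ v ∈ bundleNames k β ×ˢ B, g v ∩ Finset.Ico 1 (2 * k) = v.1 := by
      intro v hv
      obtain ⟨h1, h2⟩ := hsub v hv
      ext e
      rw [Finset.mem_inter, hmem, Finset.mem_Ico]
      constructor
      · rintro ⟨⟨rfl, -⟩ | h | h, h3⟩
        · omega
        · exact h
        · have := Finset.mem_Ico.1 (h2 h); omega
      · exact fun h => ⟨Or.inr (Or.inl h), Finset.mem_Ico.1 (h1 h)⟩
    have hsnd : ∀ v ∈ bundleNames k β ×ˢ B, g v ∩ Finset.Ico (2 * k) (2 * k + l) = v.2 := by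
      intro v hv
      obtain ⟨h1, h2⟩ := hsub v hv
      ext e
      rw [Finset.mem_inter, hmem, Finset.mem_Ico]
      constructor
      · rintro ⟨⟨rfl, -⟩ | h | h, h3⟩
        · omega
        · have := Finset.mem_Ico.1 (h1 h); omega
        · exact h
      · exact fun h => ⟨Or.inr (Or.inr h), Finset.mem_Ico.1 (h2 h)⟩
    refine Finset.card_le_card_of_injOn g ?_ ?_
    · intro v hv
      obtain ⟨h1, h2⟩ := hsub v hv
      refine Finset.mem_filter.2 ⟨Finset.mem_filter.2 ⟨?_, ?_, ?_⟩, hzero v hv⟩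
      · rw [Finset.mem_powerset]
        intro e he
        rw [Finset.mem_range]
        rcases (hmem v e).1 he with ⟨rfl, -⟩ | he | he
        · omega
        · have := Finset.mem_Ico.1 (h1 he); omega
        · exact (Finset.mem_Ico.1 (h2 he)).2
      · rw [hzero v hv, hfst v hv]; exact (Finset.mem_product.1 hv).1
      · rw [hzero v hv, hsnd v hv]; exact (Finset.mem_product.1 hv).2
    · intro v hv w hw hvw
      refine Prod.ext ?_ ?_
      · rw [← hfst v hv, ← hfst w hw, hvw]
      · rw [← hsnd v hv, ← hsnd w hw, hvw]
  have h0 := key false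
  have h1 := key true
  have hsum := Finset.card_filter_add_card_filter_not (s := extremalWords k l s)
    (fun w => decide (0 ∈ w) = true)
  simp only [Bool.not_eq_true] at hsum
  rw [mul_add]
  omega

theorem extremalWords_subset {k l : ℕ} {s : Bool → ℕ} :
    ∀ w ∈ extremalWords k l s, w ⊆ Finset.range (2 * k + l) := fun _ hw =>
  Finset.mem_powerset.1 (Finset.mem_filter.1 hw).1

theorem balanced_extremalWords {k l : ℕ} (hk : 2 ≤ k) {s : Bool → ℕ} :
    (wordPattern (2 * k + l) (2 * k) (extremalWords k l s) extremalWords_subset).Balanced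
      (2 * k + l) k (fun β => s β + 1) (fun β => l - s β + 1) := by
  set T := wordPattern (2 * k + l) (2 * k) (extremalWords k l s) extremalWords_subset with hT
  have hTh : T.h = 2 * k := rfl
  have hbit : ∀ a e, T.bit a e = decide (e ∈ (a : Finset ℕ)) := fun _ _ => rfl
  have hmem : ∀ a : extremalWords k l s, _ := fun a => (Finset.mem_filter.1 a.2).2
  have hname : ∀ a, T.ones a 1 T.h = if T.bit a 0 then k else k - 1 := fun a => by
    rw [hT, wordPattern_ones]
    exact card_of_mem_bundleNames hk (hmem a).1
  have hnamez : ∀ a, T.ones a 1 T.h + T.zeros a 1 T.h = 2 * k - 1 := fun a =>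
    T.ones_add_zeros a _ _
  have hbun : ∀ a, T.ones a T.h (2 * k + l) = s (T.bit a 0) := fun a => by
    rw [hT, wordPattern_ones]
    exact (Finset.mem_powersetCard.1 (hmem a).2).2
  have hbunz : ∀ a, T.ones a T.h (2 * k + l) + T.zeros a T.h (2 * k + l) = l := fun a => by
    rw [T.ones_add_zeros, hTh]; omega
  refine ⟨hk, by omega, ?_, ?_, ?_, ?_, ?_, ?_, ?_, ?_⟩
  · intro a b hab
    exact firstDiff_lt (extremalWords_subset a a.2) (extremalWords_subset b b.2)
      fun h => hab (Subtype.ext h)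
  · intro a ha
    have := hname a
    rw [ha] at this; simp at this; omega
  · intro a ha
    have := hname a
    have := hnamez a
    rw [ha] at *; simp at *; omega
  · intro a ha
    have := hname a
    rw [ha] at this; simp at this; omega
  · intro a ha
    have := hname a
    have := hnamez a
    rw [ha] at *; simp at *; omega
  · intro a
    exact (congrArg (· + 1) (hbun a)).le
  · intro a
    have := hbun a
    have := hbunz a
    omega
  · intro a b hab h0 ha hb
    have heq : (a : Finset ℕ) ∩ Finset.Ico 1 (2 * k) = (b : Finset ℕ) ∩ Finset.Ico 1 (2 * k) := by
      have hb1 := (hmem b).1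
      rw [← hbit b 0, ← h0] at hb1
      refine bundleNames_special (hmem a).1 hb1 ?_ ?_
      · rw [hbit a 1, hbit a 0] at ha
        simpa [show 1 < 2 * k by omega] using ha
      · rw [hbit b 1, ← h0, hbit a 0] at hb
        simpa [show 1 < 2 * k by omega] using hb
    by_contra! hcon
    refine CrossingPattern.bit_d_ne (T := T) hab ?_
    rcases Nat.eq_zero_or_pos (T.d a b) with hd | hd
    · rw [hd]; exact h0
    · rw [hbit, hbit, decide_eq_decide]
      have := Finset.ext_iff.1 heq (T.d a b)
      simpa [Finset.mem_inter, Finset.mem_Ico, show 1 ≤ T.d a b from hd,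
        show T.d a b < 2 * k from hcon] using this

/-! ### The extremal families -/

theorem InGeneralPosition.mono {F F' : Finset Flat} (hF : InGeneralPosition F) (h : F' ⊆ F) :
    InGeneralPosition F' where
  isLine a ha := hF.isLine a (h ha)
  not_vertical a ha := hF.not_vertical a (h ha)
  not_parallel a ha b hb := hF.not_parallel a (h ha) b (h hb)
  not_concurrent a ha b hb c hc := hF.not_concurrent a (h ha) b (h hb) c (h hc)

theorem SpansCell.mono {F F' : Finset Flat} {n : ℕ} (hF : SpansCell F' n) (h : F' ⊆ F) :
    SpansCell F n := by
  obtain ⟨G, hG, hG'⟩ := hF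
  exact ⟨G, hG.trans h, hG'⟩

/-- For suitable numbers `s` of ones in the names within the bundles, the lines of the extremal
words span no cell with more than `N` sides. -/
theorem exists_family {k l N M : ℕ} (hk : 2 ≤ k) (s : Bool → ℕ) (hs : ∀ β, s β ≤ l)
    (hp0 : k + 1 + (s false + 1) ≤ N) (hp1 : k + (s true + 1) ≤ N)
    (hq1 : k + 1 + (l - s true + 1) ≤ N) (hq0 : k + (l - s false + 1) ≤ N) (hl : l + 3 ≤ N)
    (hqp : (l - s false + 1) + (s true + 1) ≤ N) (hkN : 2 * k ≤ N)
    (hM : M ≤ (Nat.choose (2 * k - 2) (k - 1) + 1) *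
      (Nat.choose l (s false) + Nat.choose l (s true))) :
    ∃ F : Finset Flat, InGeneralPosition F ∧ F.card = M ∧ ¬ SpansCell F (N + 1) := by
  have hreal := wordPattern_isRealizedBy (h := 2 * k)
    (extremalWords_subset (k := k) (l := l) (s := s))
  obtain ⟨F, hF, hFM⟩ := Finset.exists_subset_card_eq
    (hM.trans ((card_extremalWords hk s).trans
      ((Fintype.card_coe _).symm.trans CrossingPattern.card_lines.symm).le) :
      M ≤ (CrossingPattern.lines _ fun w : extremalWords k l s =>
        wordIntercept (2 * k + l) (2 * k) w).card)
  refine ⟨F, hreal.inGeneralPosition.mono hF, hFM, fun hspan => ?_⟩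
  obtain ⟨U, L, x, B, hn⟩ := hreal.exists_bounds (hspan.mono hF)
  have := B.card_le_of_balanced (balanced_extremalWords hk) hp0 hp1 hq1 hq0
    (fun β => by have := hs β; omega) hqp hkN
  omega

end LineArrangement

theorem mainTheorem2 (k : ℕ) (hk : 2 ≤ k) :
    (∃ F : Finset LineArrangement.Flat,
      LineArrangement.InGeneralPosition F ∧
      F.card = 2 * (Nat.choose (2 * k - 2) (k - 1)) ^ 2 ∧
      ¬ LineArrangement.SpansCell F (2 * k + 2)) ∧
    (∃ F : Finset LineArrangement.Flat,
      LineArrangement.InGeneralPosition F ∧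
      F.card = 2 * (Nat.choose (2 * k - 2) (k - 1) + 1) * Nat.choose (2 * k - 3) (k - 1) ∧
      ¬ LineArrangement.SpansCell F (2 * k + 1)) := by
  constructor
  · refine LineArrangement.exists_family (N := 2 * k + 1) (l := 2 * k - 2) hk (fun _ => k - 1)
      ?_ ?_ ?_ ?_ ?_ ?_ ?_ ?_ ?_
    rotate_right
    · nlinarith [Nat.zero_le (Nat.choose (2 * k - 2) (k - 1))]
    all_goals omega
  · have hsymm : Nat.choose (2 * k - 3) (k - 2) = Nat.choose (2 * k - 3) (k - 1) :=
      Nat.choose_symm_of_eq_add (by omega)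
    refine LineArrangement.exists_family (N := 2 * k) (l := 2 * k - 3) hk
      (fun β => bif β then k - 1 else k - 2) (fun β => ?_) ?_ ?_ ?_ ?_ ?_ ?_ ?_ ?_
    · cases β <;> simp only [cond_true, cond_false] <;> omega
    rotate_right
    · simp only [cond_true, cond_false, hsymm]
      exact le_of_eq (by ring)
    all_goals first | omega | (simp only [cond_true, cond_false]; omega)
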